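/- Let $\nu$ be a probability distribution on $\{0,1,2,\dots\}$ with finite support, let $N=\max\{n:\nu(\{n\})>0\}$ be the maximal offspring number and $m=\sum_n n\,\nu(\{n\})$ the mean, and assume $m>1$. Let $\Lambda=\{1,\dots,N\}$ and let $(X_v)_{v\in\Lambda^*}$ be independent random variables with law $\nu$, indexed by the finite words over $\Lambda$. The Galton--Watson tree $\mathcal T$ is the union of its levels $L_0=\{\varnothing\}$, $L_{n+1}=\{vj: v\in L_n,\ 1\le j\le X_v\}$, and its boundary $\partial\mathcal T\subseteq\Lambda^{\mathbb N}$ is the set of infinite words all of whose finite prefixes lie in $\mathcal T$, with the metric $d(v,w)=e^{-|v\wedge w|}$ for $v\neq w$ and $d(v,v)=0$, where $|v\wedge w|$ is the length of the longest common prefix. Non-extinction is the event that $Z_k=\#L_k>0$ for all $k$. A dimension function is a function $\phi:(0,1)\to(0,\infty)$ such that $\phi(R)$ is non-increasing as $R$ decreases to $0$, while $\phi(R)\log(1/R)$ is non-decreasing as $R$ decreases to $0$ and tends to $\infty$. For a metric space $F$ let $N_r(E)$ be the least number of open balls of radius $r$ (in $F$) covering $E\subseteq F$, and put $$\dim_{\mathrm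 A}^{\phi}F=\inf\Bigl\{s\in\mathbb R:\exists C>0\ \forall\, 0<R<1\ \forall x\in F:\ N_{R^{1+\phi(R)}}(B(x,R))\le C R^{-\phi(R)s}\Bigr\},$$ $$\overline{\dim}_{\mathrm A}^{\phi}F=\inf\Bigl\{s\in\mathbb R:\exists C>0\ \forall\, 0<r\le R^{1+\phi(R)},\ 0<R<1\ \forall x\in F:\ N_{r}(B(x,R))\le C (R/r)^{s}\Bigr\},$$ and let the Assouad dimension $\dim_{\mathrm A}F$ be defined as $\overline{\dim}_{\mathrm A}^{\phi}F$, but with the condition $0<r\le R<1$ on the scales. Let $$\psi(R)=\frac{\log\log(1/R)}{\log(1/R)}.$$ Then, almost surely conditioned on non-extinction, the following holds simultaneously for all dimension functions $\phi$. If $\lim_{R\to0}\psi(R)/\phi(R)=\alpha\in[0,\log N]$, then $$\overline{\dim}_{\mathrm A}^{\phi}\,\partial\mathcal T=\dim_{\mathrm A}^{\phi}\,\partial\mathcal T=\alpha\Bigl(1-\frac{\log m}{\log N}\Bigr)+\log m .$$ If $\lim_{R\to0}\psi(R)/\phi(R)$ exists in $[\log N,\infty]$, then $$\dim_{\mathrm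 A}\partial\mathcal T=\dim_{\mathrm A}^{\phi}\,\partial\mathcal T=\log N .$$ -/

import Mathlib

open MeasureTheory ProbabilityTheory Filter
open scoped Topology ENNReal

/-! ### Generalized Assouad dimensions of a metric space -/

namespace AssouadDim

/-- `ballCoverNumber r E` is `N_r(E)`: the smallest number of open balls of radius `r`
(with centres in the ambient metric space `F`) required to cover `E`;
it is `⊤` if no finite number suffices. -/
noncomputable def ballCoverNumber {F : Type*} [PseudoMetricSpace F] (r : ℝ) (E : Set F) : ℕ∞ :=
  ⨅ (t : Set F) (_ : E ⊆ ⋃ x ∈ t, Metric.ball x r), t.encard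

/-- A dimension function `φ : (0,1) → ℝ⁺`; only the values on `(0,1)` matter. Both monotonicity
requirements are in the weak sense. -/
structure IsDimensionFunction (φ : ℝ → ℝ) : Prop where
  pos : ∀ R ∈ Set.Ioo (0 : ℝ) 1, 0 < φ R
  gap_antitone : AntitoneOn (fun R => φ R * Real.log (1 / R)) (Set.Ioo 0 1)
  gap_tendsto : Tendsto (fun R => φ R * Real.log (1 / R)) (𝓝[>] 0) atTop
  monotone : MonotoneOn φ (Set.Ioo 0 1)

/-- The `φ`-Assouad dimension of the metric space `F`, as an infimum in the extended reals
of a set of real numbers `s`. -/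
noncomputable def phiAssouadDim (φ : ℝ → ℝ) (F : Type*) [PseudoMetricSpace F] : EReal :=
  ⨅ (s : ℝ) (_ : ∃ C : ℝ, 0 < C ∧ ∀ R : ℝ, 0 < R → R < 1 → ∀ x : F,
      (ballCoverNumber (R ^ (1 + φ R)) (Metric.ball x R) : ℝ≥0∞)
        ≤ ENNReal.ofReal (C * R ^ (-(φ R * s)))), (s : EReal)

/-- The upper `φ`-Assouad dimension of the metric space `F`. -/
noncomputable def upperPhiAssouadDim (φ : ℝ → ℝ) (F : Type*) [PseudoMetricSpace F] : EReal :=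
  ⨅ (s : ℝ) (_ : ∃ C : ℝ, 0 < C ∧ ∀ r R : ℝ, 0 < r → r ≤ R ^ (1 + φ R) → 0 < R → R < 1 →
      ∀ x : F, (ballCoverNumber r (Metric.ball x R) : ℝ≥0∞)
        ≤ ENNReal.ofReal (C * (R / r) ^ s)), (s : EReal)

/-- The Assouad dimension of the metric space `F`. -/
noncomputable def assouadDim (F : Type*) [PseudoMetricSpace F] : EReal :=
  ⨅ (s : ℝ) (_ : ∃ C : ℝ, 0 < C ∧ ∀ r R : ℝ, 0 < r → r ≤ R → R < 1 →
      ∀ x : F, (ballCoverNumber r (Metric.ball x R) : ℝ≥0∞)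
        ≤ ENNReal.ofReal (C * (R / r) ^ s)), (s : EReal)

/-- `ψ(R) = log log (1/R) / log (1/R)`. -/
noncomputable def logLogRate (R : ℝ) : ℝ :=
  Real.log (Real.log (1 / R)) / Real.log (1 / R)

end AssouadDim

/-! ### Galton–Watson trees and their boundaries

The alphabet is `Fin N`, finite words are lists, and a tree is encoded by the offspring numbers
`c v` of all finite words `v`. -/

namespace GWTree

/-- Infinite words over the alphabet `Fin N`. -/
def InfWord (N : ℕ) : Type := ℕ → Fin N

/-- The length `|v ∧ w|` of the longest common prefix of two distinct infinite words. -/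
noncomputable def commonLength {N : ℕ} (v w : InfWord N) : ℕ :=
  PiNat.firstDiff (E := fun _ => Fin N) v w

open Classical in
/-- The metric `d(v, w) = exp (-|v ∧ w|)` for `v ≠ w`, and `d(v, v) = 0`. -/
noncomputable instance (N : ℕ) : MetricSpace (InfWord N) where
  dist v w := if v = w then 0 else Real.exp (-(commonLength v w : ℝ))
  dist_self v := by simp
  dist_comm v w := by
    simp only [commonLength, PiNat.firstDiff_comm (E := fun _ => Fin N) v w, eq_comm]
  dist_triangle u v w := by
    by_cases huw : u = w
    · simp only [huw, if_true]
      split_ifs <;> positivity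
    by_cases huv : u = v
    · simp [huv]
    by_cases hvw : v = w
    · simp [hvw]
    simp only [huw, huv, hvw, if_false]
    have h := PiNat.min_firstDiff_le (E := fun _ => Fin N) u v w huw
    rcases min_le_iff.1 h with h | h
    · have h1 : Real.exp (-(commonLength u w : ℝ)) ≤ Real.exp (-(commonLength u v : ℝ)) :=
        Real.exp_le_exp.2 (neg_le_neg (Nat.cast_le.2 h))
      linarith [Real.exp_pos (-(commonLength v w : ℝ))]
    · have h1 : Real.exp (-(commonLength u w : ℝ)) ≤ Real.exp (-(commonLength v w : ℝ)) :=
        Real.exp_le_exp.2 (neg_le_neg (Nat.cast_le.2 h))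
      linarith [Real.exp_pos (-(commonLength u v : ℝ))]
  eq_of_dist_eq_zero := by
    intro v w h
    by_contra hne
    simp only [hne, if_false] at h
    exact (Real.exp_pos _).ne' h

/-- The prefix of length `n` of an infinite word. -/
def InfWord.take {N : ℕ} (x : InfWord N) (n : ℕ) : List (Fin N) :=
  List.ofFn (fun i : Fin n => x i)

/-- The `n`-th level of the tree: the root is the empty word, and a word `v` of the tree has as
children the words `v j` where `j` is one of the first `c v` letters. -/
def level {N : ℕ} (c : List (Fin N) → ℕ) : ℕ → Set (List (Fin N))
  | 0 => {[]}
  | n + 1 => {w | ∃ v ∈ level c n, ∃ j : Fin N, (j : ℕ) < c v ∧ w = v ++ [j]}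

/-- The tree: the set of all its nodes. -/
def tree {N : ℕ} (c : List (Fin N) → ℕ) : Set (List (Fin N)) := ⋃ n, level c n

/-- The boundary of the tree: the infinite words all of whose prefixes are in the tree. It carries
the metric induced from the space of infinite words. -/
def boundary {N : ℕ} (c : List (Fin N) → ℕ) : Set (InfWord N) :=
  {x | ∀ n, x.take n ∈ tree c}

/-- The size `Z_k` of the `k`-th generation (the levels are finite sets). -/
noncomputable def genSize {N : ℕ} (c : List (Fin N) → ℕ) (k : ℕ) : ℕ := (level c k).ncard

end GWTree

open AssouadDim GWTree

namespace GWTree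

/-- The subtree environment seen from the word `v`. -/
def shift {N : ℕ} (v : List (Fin N)) (c : List (Fin N) → ℕ) : List (Fin N) → ℕ :=
  fun u => c (v ++ u)

@[simp] lemma shift_nil {N : ℕ} (c : List (Fin N) → ℕ) : shift [] c = c := rfl

lemma shift_shift {N : ℕ} (v u : List (Fin N)) (c : List (Fin N) → ℕ) :
    shift u (shift v c) = shift (v ++ u) c := by
  funext w; simp [shift]

/-- The letters of the children of the root. -/
def children {N : ℕ} (k : ℕ) : Finset (Fin N) := Finset.univ.filter fun j : Fin N => (j : ℕ) < k

/-- The levels of the tree as finite sets, by recursion at the root. -/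
def lev {N : ℕ} : ℕ → (List (Fin N) → ℕ) → Finset (List (Fin N))
  | 0, _ => {[]}
  | n + 1, c => (children (c [])).biUnion fun j =>
      (lev n (shift [j] c)).map ⟨List.cons j, List.cons_injective⟩

lemma mem_lev_succ {N : ℕ} {c : List (Fin N) → ℕ} {n : ℕ} {w : List (Fin N)} :
    w ∈ lev (n + 1) c ↔ ∃ j : Fin N, (j : ℕ) < c [] ∧ ∃ u ∈ lev n (shift [j] c), w = j :: u := by
  simp [lev, children, eq_comm]

lemma mem_lev_succ' {N : ℕ} {n : ℕ} {c : List (Fin N) → ℕ} {w : List (Fin N)} :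
    w ∈ lev (n + 1) c ↔ ∃ v ∈ lev n c, ∃ j : Fin N, (j : ℕ) < c v ∧ w = v ++ [j] := by
  induction n generalizing c w with
  | zero => simp [lev, children]
  | succ n ih =>
    rw [mem_lev_succ]
    constructor
    · rintro ⟨j, hj, u, hu, rfl⟩
      obtain ⟨v, hv, i, hi, rfl⟩ := ih.1 hu
      exact ⟨j :: v, mem_lev_succ.2 ⟨j, hj, v, hv, rfl⟩, i, hi, rfl⟩
    · rintro ⟨v, hv, i, hi, rfl⟩
      obtain ⟨j, hj, u, hu, rfl⟩ := mem_lev_succ.1 hv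
      exact ⟨j, hj, u ++ [i], ih.2 ⟨u, hu, i, hi, rfl⟩, rfl⟩

lemma coe_lev {N : ℕ} (c : List (Fin N) → ℕ) (n : ℕ) : (lev n c : Set (List (Fin N))) = level c n := by
  induction n with
  | zero => simp [lev, level]
  | succ n ih =>
    ext w
    simp only [Finset.mem_coe, mem_lev_succ', level, Set.mem_ofPred_eq, ← ih]

lemma length_of_mem_lev {N : ℕ} {n : ℕ} {c : List (Fin N) → ℕ} {w : List (Fin N)}
    (hw : w ∈ lev n c) : w.length = n := by
  induction n generalizing w with
  | zero => simpa [lev] using hw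
  | succ n ih =>
    obtain ⟨v, hv, j, -, rfl⟩ := mem_lev_succ'.1 hw
    simp [ih hv]

lemma genSize_eq {N : ℕ} (c : List (Fin N) → ℕ) (k : ℕ) : genSize c k = (lev k c).card := by
  rw [genSize, ← coe_lev, Set.ncard_coe_finset]

lemma append_mem_lev {N : ℕ} {n g : ℕ} {c : List (Fin N) → ℕ} {v u : List (Fin N)}
    (hv : v ∈ lev n c) : v ++ u ∈ lev (n + g) c ↔ u ∈ lev g (shift v c) := by
  induction n generalizing c v with
  | zero =>
    have : v = [] := by simpa [lev] using hv
    subst this; simp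
  | succ n ih =>
    obtain ⟨j, hj, v, hv', rfl⟩ := mem_lev_succ.1 hv
    rw [show n + 1 + g = (n + g) + 1 by ring, mem_lev_succ]
    have := ih hv'
    rw [shift_shift] at this
    simp only [List.cons_append, List.nil_append] at this ⊢
    rw [← this]
    constructor
    · rintro ⟨i, hi, w, hw, h⟩
      obtain ⟨rfl, rfl⟩ := List.cons.inj h
      exact hw
    · intro h
      exact ⟨j, hj, _, h, rfl⟩

lemma mem_boundary_iff {N : ℕ} {c : List (Fin N) → ℕ} {x : InfWord N} :
    x ∈ boundary c ↔ ∀ n, x.take n ∈ lev n c := by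
  refine forall_congr' fun n => ?_
  simp only [tree, Set.mem_iUnion, ← coe_lev, Finset.mem_coe]
  refine ⟨fun ⟨k, hk⟩ => ?_, fun h => ⟨n, h⟩⟩
  have := length_of_mem_lev hk
  simp only [InfWord.take, List.length_ofFn] at this
  subst this; exact hk

/-- The tree does not die out. -/
def Alive {N : ℕ} (c : List (Fin N) → ℕ) : Prop := ∀ k, (lev k c).Nonempty

lemma lev_nonempty_of_le {N : ℕ} {c : List (Fin N) → ℕ} {k l : ℕ} (h : k ≤ l)
    (hl : (lev l c).Nonempty) : (lev k c).Nonempty := by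
  induction l, h using Nat.le_induction with
  | base => exact hl
  | succ l _ ih =>
    obtain ⟨w, hw⟩ := hl
    obtain ⟨v, hv, -⟩ := mem_lev_succ'.1 hw
    exact ih ⟨v, hv⟩

lemma Alive.exists_child {N : ℕ} {c : List (Fin N) → ℕ} (h : Alive c) :
    ∃ j : Fin N, (j : ℕ) < c [] ∧ Alive (shift [j] c) := by
  by_contra! hc
  have h1 : ∀ j : Fin N, ∃ k, (j : ℕ) < c [] → ¬ (lev k (shift [j] c)).Nonempty := by
    intro j
    by_cases hj : (j : ℕ) < c []
    · have := hc j hj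
      simp only [Alive, not_forall] at this
      obtain ⟨k, hk⟩ := this
      exact ⟨k, fun _ => hk⟩
    · exact ⟨0, fun h => absurd h hj⟩
  choose k hk using h1
  obtain ⟨w, hw⟩ := h (Finset.univ.sup k + 1)
  obtain ⟨j, hj, u, hu, -⟩ := mem_lev_succ.1 hw
  exact hk j hj (lev_nonempty_of_le (Finset.le_sup (Finset.mem_univ j)) ⟨u, hu⟩)

lemma alive_of_child {N : ℕ} {c : List (Fin N) → ℕ} {j : Fin N} (hj : (j : ℕ) < c [])
    (h : Alive (shift [j] c)) : Alive c := by
  intro k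
  refine lev_nonempty_of_le (Nat.le_succ k) ?_
  obtain ⟨u, hu⟩ := h k
  exact ⟨_, mem_lev_succ.2 ⟨j, hj, u, hu, rfl⟩⟩

lemma InfWord.take_succ {N : ℕ} (x : InfWord N) (n : ℕ) : x.take (n + 1) = x.take n ++ [x n] := by
  rw [InfWord.take, List.ofFn_succ_last]; rfl

lemma InfWord.length_take {N : ℕ} (x : InfWord N) (n : ℕ) : (x.take n).length = n := by
  simp [InfWord.take]

lemma InfWord.take_take {N : ℕ} (x : InfWord N) (n g : ℕ) : (x.take (n + g)).take n = x.take n := by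
  induction g with
  | zero => simp [List.take_of_length_le (InfWord.length_take x n).le]
  | succ g ih =>
    rw [← add_assoc, InfWord.take_succ, List.take_append_of_le_length, ih]
    simp [InfWord.length_take]

lemma exists_mem_boundary_take {N : ℕ} {c : List (Fin N) → ℕ} {n : ℕ} {v : List (Fin N)}
    (hv : v ∈ lev n c) (ha : Alive (shift v c)) : ∃ x ∈ boundary c, x.take n = v := by
  have step : ∀ w : List (Fin N), ∃ j : Fin N, Alive (shift w c) →
      (j : ℕ) < c w ∧ Alive (shift (w ++ [j]) c) := by
    intro w
    by_cases hw : Alive (shift w c)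
    · obtain ⟨j, hj, h⟩ := hw.exists_child
      rw [shift_shift] at h
      exact ⟨j, fun _ => ⟨by simpa [shift] using hj, h⟩⟩
    · obtain ⟨j, -⟩ := ha.exists_child
      exact ⟨j, fun h => absurd h hw⟩
  choose f hf using step
  let W : ℕ → List (Fin N) := fun k => Nat.rec v (fun _ w => w ++ [f w]) k
  have hW : ∀ k, W (k + 1) = W k ++ [f (W k)] := fun k => rfl
  have hWa : ∀ k, W k ∈ lev (n + k) c ∧ Alive (shift (W k) c) := by
    intro k
    induction k with
    | zero => exact ⟨hv, ha⟩
    | succ k ih =>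
      rw [hW]
      exact ⟨mem_lev_succ'.2 ⟨W k, ih.1, _, (hf _ ih.2).1, rfl⟩, (hf _ ih.2).2⟩
  have hlen := length_of_mem_lev hv
  let x : InfWord N := fun i => if h : i < n then v[i] else f (W (i - n))
  have hx0 : x.take n = v := by
    refine List.ext_getElem (by simp [InfWord.take, hlen]) fun i h1 h2 => ?_
    simp [InfWord.take, x]
  have hx : ∀ k, x.take (n + k) = W k := by
    intro k
    induction k with
    | zero => exact hx0
    | succ k ih =>
      rw [← add_assoc, InfWord.take_succ, ih, hW]
      simp [x]
  refine ⟨x, mem_boundary_iff.2 fun k => ?_, hx0⟩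
  have hk : ∀ k, x.take (n + k) ∈ lev (n + k) c := fun k => by rw [hx]; exact (hWa k).1
  have hdown : ∀ i, x.take (i + 1) ∈ lev (i + 1) c → x.take i ∈ lev i c := by
    intro i hi
    obtain ⟨u, hu, j, -, h⟩ := mem_lev_succ'.1 hi
    rw [InfWord.take_succ] at h
    rw [(List.append_inj' h rfl).1]; exact hu
  have hdown' : ∀ d, x.take (k + d) ∈ lev (k + d) c → x.take k ∈ lev k c := by
    intro d
    induction d with
    | zero => exact id
    | succ d ih => exact fun h => ih (hdown _ h)
  exact hdown' n (by rw [add_comm k n]; exact hk k)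

/-- The length of the common prefix that the open ball of radius `r` prescribes. -/
noncomputable def ballLen (r : ℝ) : ℕ := ⌊Real.log (1 / r)⌋₊ + 1

lemma dist_lt_iff {N : ℕ} (x y : InfWord N) {r : ℝ} (h0 : 0 < r) (h1 : r ≤ 1) :
    dist x y < r ↔ x.take (ballLen r) = y.take (ballLen r) := by
  by_cases hxy : x = y
  · simp [hxy, h0]
  have hd : dist x y = Real.exp (-(commonLength x y : ℝ)) := by simp only [dist, if_neg hxy]
  have hlog : 0 ≤ Real.log (1 / r) := Real.log_nonneg (by rw [le_div_iff₀ h0]; linarith)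
  rw [hd, ← Real.lt_log_iff_exp_lt h0, neg_lt]
  have : -Real.log r = Real.log (1 / r) := by simp
  rw [this, ← Nat.floor_lt hlog, ← Nat.succ_le_iff, commonLength,
    ← PiNat.mem_cylinder_iff_le_firstDiff (E := fun _ => Fin N) hxy]
  change (∀ i < ballLen r, x i = y i) ↔ _
  simp only [InfWord.take]
  rw [List.ofFn_inj, funext_iff]
  exact ⟨fun h i => h i i.2, fun h i hi => h ⟨i, hi⟩⟩

open Classical in
/-- The nodes of the `g`-th level from which the tree does not die out. -/
noncomputable def aliveLev {N : ℕ} (g : ℕ) (c : List (Fin N) → ℕ) : Finset (List (Fin N)) :=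
  (lev g c).filter fun u => Alive (shift u c)

lemma ballCoverNumber_le {N : ℕ} {c : List (Fin N) → ℕ} (x : boundary c) {r R : ℝ} {n g : ℕ}
    (hr0 : 0 < r) (hr1 : r ≤ 1) (hR0 : 0 < R) (hR1 : R ≤ 1) (hn : ballLen R = n)
    (hg : ballLen r = n + g) :
    ballCoverNumber r (Metric.ball x R) ≤ ((lev g (shift (x.1.take n) c)).card : ℕ∞) := by
  classical
  let B : Finset (List (Fin N)) := (lev g (shift (x.1.take n) c)).filter
    fun u => ∃ y : boundary c, y.1.take (n + g) = x.1.take n ++ u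
  have : ∀ u ∈ B, ∃ y : boundary c, y.1.take (n + g) = x.1.take n ++ u := fun u hu =>
    (Finset.mem_filter.1 hu).2
  have : Nonempty (boundary c) := ⟨x⟩
  choose! f hf using ‹∀ u ∈ B, _›
  have hcov : Metric.ball x R ⊆ ⋃ y ∈ f '' (B : Set (List (Fin N))), Metric.ball y r := by
    intro z hz
    have hz1 : dist z.1 x.1 < R := hz
    rw [dist_lt_iff _ _ hR0 hR1, hn] at hz1
    have hmem := mem_boundary_iff.1 z.2
    have hsplit := List.take_append_drop n (z.1.take (n + g))
    rw [InfWord.take_take, hz1] at hsplit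
    have hu : (z.1.take (n + g)).drop n ∈ B := by
      refine Finset.mem_filter.2 ⟨(append_mem_lev (mem_boundary_iff.1 x.2 n)).1 ?_, z, hsplit.symm⟩
      rw [hsplit]; exact hmem _
    refine Set.mem_iUnion₂.2 ⟨f _, ⟨_, hu, rfl⟩, ?_⟩
    change dist z.1 (f _).1 < r
    rw [dist_lt_iff _ _ hr0 hr1, hg, hf _ hu, hsplit]
  refine (iInf₂_le (f := fun (t : Set (boundary c)) (_ : Metric.ball x R ⊆ ⋃ y ∈ t, Metric.ball y r) =>
    t.encard) _ hcov).trans ?_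
  refine (Set.encard_image_le _ _).trans ?_
  rw [Set.encard_coe_eq_coe_finsetCard]
  exact_mod_cast Finset.card_filter_le _ _

lemma le_ballCoverNumber {N : ℕ} {c : List (Fin N) → ℕ} (x : boundary c) {r R : ℝ} {n g : ℕ}
    (hr0 : 0 < r) (hr1 : r ≤ 1) (hR0 : 0 < R) (hR1 : R ≤ 1) (hn : ballLen R = n)
    (hg : ballLen r = n + g) :
    ((aliveLev g (shift (x.1.take n) c)).card : ℕ∞) ≤ ballCoverNumber r (Metric.ball x R) := by
  classical
  refine le_iInf₂ fun t ht => ?_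
  have hsub : ((aliveLev g (shift (x.1.take n) c)).map
      ⟨(x.1.take n ++ ·), List.append_right_injective _⟩ : Set (List (Fin N))) ⊆
      (fun y : boundary c => y.1.take (n + g)) '' t := by
    intro w hw
    simp only [aliveLev, Finset.coe_map, Function.Embedding.coeFn_mk, Set.mem_image,
      Finset.mem_coe, Finset.mem_filter] at hw
    obtain ⟨u, ⟨hu, ha⟩, rfl⟩ := hw
    rw [shift_shift] at ha
    have hxn := mem_boundary_iff.1 x.2 n
    obtain ⟨z, hz, hzt⟩ := exists_mem_boundary_take ((append_mem_lev hxn).2 hu) ha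
    have hzx : z.take n = x.1.take n := by
      rw [← InfWord.take_take z n g, hzt, List.take_left' (InfWord.length_take _ _)]
    have hzb : (⟨z, hz⟩ : boundary c) ∈ Metric.ball x R := by
      change dist z x.1 < R
      rw [dist_lt_iff _ _ hR0 hR1, hn, hzx]
    obtain ⟨y, hy, hzy⟩ := Set.mem_iUnion₂.1 (ht hzb)
    have hzy : dist z y.1 < r := hzy
    rw [dist_lt_iff _ _ hr0 hr1, hg] at hzy
    exact ⟨y, hy, hzy.symm.trans hzt⟩
  calc ((aliveLev g (shift (x.1.take n) c)).card : ℕ∞)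
      = ((aliveLev g (shift (x.1.take n) c)).map
      ⟨(x.1.take n ++ ·), List.append_right_injective _⟩ : Set (List (Fin N))).encard := by
        rw [Set.encard_coe_eq_coe_finsetCard, Finset.card_map]
    _ ≤ _ := Set.encard_le_encard hsub
    _ ≤ _ := Set.encard_image_le _ _

lemma card_lev_le {N : ℕ} (g : ℕ) (c : List (Fin N) → ℕ) : (lev g c).card ≤ N ^ g := by
  have : lev g c ⊆ Finset.univ.image (fun v : List.Vector (Fin N) g => v.1) := by
    intro w hw
    exact Finset.mem_image.2 ⟨⟨w, length_of_mem_lev hw⟩, Finset.mem_univ _, rfl⟩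
  calc (lev g c).card ≤ _ := Finset.card_le_card this
    _ ≤ _ := Finset.card_image_le
    _ = N ^ g := by simp [card_vector]

end GWTree

namespace GWTree

/-- The law of the family of offspring numbers. -/
noncomputable def envLaw (N : ℕ) (ν : Measure ℕ) [IsProbabilityMeasure ν] :
    Measure (List (Fin N) → ℕ) :=
  Measure.infinitePi fun _ => ν

instance {N : ℕ} {ν : Measure ℕ} [IsProbabilityMeasure ν] : IsProbabilityMeasure (envLaw N ν) := by
  unfold envLaw; infer_instance

lemma measurable_shift {N : ℕ} (v : List (Fin N)) : Measurable (shift v) :=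
  measurable_pi_lambda _ fun _ => measurable_pi_apply _

lemma map_shift_envLaw {N : ℕ} (ν : Measure ℕ) [IsProbabilityMeasure ν] (v : List (Fin N)) :
    (envLaw N ν).map (shift v) = envLaw N ν :=
  Measure.map_infinitePi_infinitePi_of_inj (P := fun _ : List (Fin N) => ν)
    (List.append_right_injective v)

lemma measurePreserving_shift {N : ℕ} (ν : Measure ℕ) [IsProbabilityMeasure ν]
    (v : List (Fin N)) : MeasurePreserving (shift v) (envLaw N ν) (envLaw N ν) :=
  ⟨measurable_shift v, map_shift_envLaw ν v⟩

lemma map_family_eq_envLaw {Ω : Type*} [MeasurableSpace Ω] {P : Measure Ω} {N : ℕ} {ν : Measure ℕ}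
    [IsProbabilityMeasure ν] {X : List (Fin N) → Ω → ℕ} (hX : ∀ v, Measurable (X v))
    (hlaw : ∀ v, P.map (X v) = ν) (hindep : iIndepFun X P) :
    P.map (fun ω v => X v ω) = envLaw N ν := by
  rw [hindep.map_fun_eq_infinitePi_map hX]
  simp only [hlaw, envLaw]

/-- Join a root label and a family of trees. -/
def glue {N : ℕ} (p : ℕ × (Fin N → List (Fin N) → ℕ)) : List (Fin N) → ℕ
  | [] => p.1
  | j :: u => p.2 j u

lemma measurable_glue {N : ℕ} : Measurable (glue (N := N)) := by
  refine measurable_pi_lambda _ fun v => ?_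
  cases v with
  | nil => exact measurable_fst
  | cons j u => exact (measurable_pi_apply u).comp ((measurable_pi_apply j).comp measurable_snd)

lemma prod_list_eq {N : ℕ} (s : Finset (List (Fin N))) (F : List (Fin N) → ℝ≥0∞) :
    ∏ v ∈ s, F v = (if [] ∈ s then F [] else 1) *
      ∏ j : Fin N, ∏ u ∈ s.preimage (List.cons j) List.cons_injective.injOn, F (j :: u) := by
  classical
  have h1 : ∏ v ∈ s.filter (· = []), F v = if [] ∈ s then F [] else 1 := by
    have : s.filter (· = []) = if [] ∈ s then {[]} else ∅ := by
      ext w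
      split_ifs with h <;> simp only [Finset.mem_filter, Finset.mem_singleton, Finset.notMem_empty]
      · exact ⟨fun h => h.2, fun hw => ⟨hw ▸ h, hw⟩⟩
      · exact iff_of_false (fun hw => h (hw.2 ▸ hw.1)) id
    rw [this]
    split_ifs <;> simp
  have h2 : s.filter (¬ · = []) = Finset.univ.biUnion fun j : Fin N =>
      (s.preimage (List.cons j) List.cons_injective.injOn).map
        ⟨List.cons j, List.cons_injective⟩ := by
    ext w
    cases w <;> simp
  rw [← Finset.prod_filter_mul_prod_filter_not s (· = []), h1, h2, Finset.prod_biUnion]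
  · simp
  · intro i _ j _ hij
    rw [Function.onFun, Finset.disjoint_left]
    intro w hw hw'
    simp only [Finset.mem_map, Function.Embedding.coeFn_mk] at hw hw'
    obtain ⟨u, -, rfl⟩ := hw
    obtain ⟨u', -, h⟩ := hw'
    exact hij (List.cons.inj h).1.symm

lemma map_glue {N : ℕ} (ν : Measure ℕ) [IsProbabilityMeasure ν] :
    (ν.prod (Measure.pi fun _ : Fin N => envLaw N ν)).map glue = envLaw N ν := by
  refine Measure.eq_infinitePi _ fun s t ht => ?_
  rw [Measure.map_apply measurable_glue (.pi s.countable_toSet fun _ _ => ht _)]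
  have : glue ⁻¹' (Set.pi s t) = (if [] ∈ s then t [] else Set.univ) ×ˢ
      Set.univ.pi fun j : Fin N => Set.pi
        (s.preimage (List.cons j) List.cons_injective.injOn) fun u => t (j :: u) := by
    ext ⟨k, e⟩
    simp only [Set.mem_preimage, Set.mem_pi, Finset.mem_coe, Set.mem_prod, Set.mem_univ,
      true_implies, Finset.mem_preimage]
    constructor
    · intro h
      refine ⟨?_, fun j u hu => h (j :: u) hu⟩
      split_ifs with h0
      · exact h [] h0
      · trivial
    · rintro ⟨h1, h2⟩ v hv
      cases v with
      | nil =>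
        rw [if_pos hv] at h1
        exact h1
      | cons j u => exact h2 j u hv
  rw [this, Measure.prod_prod, Measure.pi_pi, prod_list_eq]
  congr 1
  · split_ifs <;> simp
  · refine Finset.prod_congr rfl fun j _ => ?_
    exact Measure.infinitePi_pi _ fun u _ => ht _

lemma lintegral_envLaw_eq {N : ℕ} (ν : Measure ℕ) [IsProbabilityMeasure ν]
    {H : ℕ → (Fin N → List (Fin N) → ℕ) → ℝ≥0∞} (hH : ∀ k, Measurable (H k)) :
    ∫⁻ c, H (c []) (fun j => shift [j] c) ∂(envLaw N ν) =
      ∫⁻ k, ∫⁻ e, H k e ∂(Measure.pi fun _ : Fin N => envLaw N ν) ∂ν := by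
  have hH' : Measurable (fun p : ℕ × (Fin N → List (Fin N) → ℕ) => H p.1 p.2) :=
    measurable_from_prod_countable_right hH
  have hm : Measurable fun c : List (Fin N) → ℕ => (c [], fun j : Fin N => shift [j] c) :=
    (measurable_pi_apply _).prodMk (measurable_pi_lambda _ fun j => measurable_shift [j])
  nth_rewrite 1 [← map_glue ν]
  refine (lintegral_map (hH'.comp hm) measurable_glue).trans ?_
  refine (lintegral_prod _ ((hH'.comp hm).comp measurable_glue).aemeasurable).trans ?_
  rfl

lemma lintegral_pi_prod {N : ℕ} {E : Type*} [MeasurableSpace E] (μ : Measure E)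
    [IsProbabilityMeasure μ] {Y : Fin N → E → ℝ≥0∞} (hY : ∀ j, Measurable (Y j)) :
    ∫⁻ e, ∏ j, Y j (e j) ∂(Measure.pi fun _ : Fin N => μ) = ∏ j, ∫⁻ c, Y j c ∂μ := by
  have hind : iIndepFun (fun (j : Fin N) (e : Fin N → E) => Y j (e j))
      (Measure.pi fun _ : Fin N => μ) :=
    iIndepFun_pi (X := fun j => Y j) fun j => (hY j).aemeasurable
  rw [lintegral_prod_eq_prod_lintegral_of_indepFun Finset.univ _ hind
    fun j => (hY j).comp (measurable_pi_apply j)]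
  refine Finset.prod_congr rfl fun j _ => ?_
  exact (measurePreserving_eval (fun _ : Fin N => μ) j).lintegral_comp (hY j)

/-- The product of `Y` over the subtrees rooted at the nodes of the `n`-th level. -/
noncomputable def levProd {N : ℕ} (Y : (List (Fin N) → ℕ) → ℝ≥0∞) (n : ℕ)
    (c : List (Fin N) → ℕ) : ℝ≥0∞ :=
  ∏ u ∈ lev n c, Y (shift u c)

@[to_additive]
lemma prod_lev_succ {N : ℕ} {M : Type*} [CommMonoid M] (n : ℕ) (c : List (Fin N) → ℕ)
    (f : List (Fin N) → M) :
    ∏ u ∈ lev (n + 1) c, f u = ∏ j ∈ children (c []), ∏ u ∈ lev n (shift [j] c), f (j :: u) := by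
  rw [lev, Finset.prod_biUnion]
  · simp
  · intro i _ j _ hij
    rw [Function.onFun, Finset.disjoint_left]
    intro w hw hw'
    simp only [Finset.mem_map, Function.Embedding.coeFn_mk] at hw hw'
    obtain ⟨u, -, rfl⟩ := hw
    obtain ⟨u', -, h⟩ := hw'
    exact hij (List.cons.inj h).1.symm

lemma levProd_zero {N : ℕ} (Y : (List (Fin N) → ℕ) → ℝ≥0∞) (c : List (Fin N) → ℕ) :
    levProd Y 0 c = Y c := by
  simp [levProd, lev]

lemma levProd_succ {N : ℕ} (Y : (List (Fin N) → ℕ) → ℝ≥0∞) (n : ℕ) (c : List (Fin N) → ℕ) :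
    levProd Y (n + 1) c = ∏ j : Fin N, if (j : ℕ) < c [] then levProd Y n (shift [j] c) else 1 := by
  rw [levProd, prod_lev_succ, children, Finset.prod_filter]
  simp [levProd, shift_shift]

lemma measurable_levProd {N : ℕ} {Y : (List (Fin N) → ℕ) → ℝ≥0∞} (hY : Measurable Y) (n : ℕ) :
    Measurable (levProd Y n) := by
  induction n with
  | zero => simpa only [funext (levProd_zero Y)] using hY
  | succ n ih =>
    rw [funext (levProd_succ Y n)]
    refine Finset.measurable_prod _ fun j _ => Measurable.ite ?_ (ih.comp (measurable_shift _))
      measurable_const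
    exact measurableSet_lt measurable_const (measurable_pi_apply _)

/-- The generating function of the offspring numbers, capped at `N`. -/
noncomputable def pgf (N : ℕ) (ν : Measure ℕ) (s : ℝ≥0∞) : ℝ≥0∞ :=
  ∫⁻ k, s ^ (children (N := N) k).card ∂ν

lemma lintegral_levProd {N : ℕ} (ν : Measure ℕ) [IsProbabilityMeasure ν]
    {Y : (List (Fin N) → ℕ) → ℝ≥0∞} (hY : Measurable Y) (n : ℕ) :
    ∫⁻ c, levProd Y n c ∂(envLaw N ν) = (pgf N ν)^[n] (∫⁻ c, Y c ∂(envLaw N ν)) := by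
  induction n with
  | zero => simp [levProd_zero]
  | succ n ih =>
    have hm := measurable_levProd hY n
    have hite : ∀ (k : ℕ) (j : Fin N), Measurable fun c : List (Fin N) → ℕ =>
        if (j : ℕ) < k then levProd Y n c else 1 := by
      intro k j
      split_ifs
      exacts [hm, measurable_const]
    rw [Function.iterate_succ_apply', ← ih, funext (levProd_succ Y n),
      lintegral_envLaw_eq ν (H := fun k e =>
        ∏ j : Fin N, if (j : ℕ) < k then levProd Y n (e j) else 1)
        fun k => Finset.measurable_prod _ fun j _ => (hite k j).comp (measurable_pi_apply j), pgf]
    refine lintegral_congr fun k => ?_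
    rw [lintegral_pi_prod (envLaw N ν) (hite k)]
    simp only [children, ← Finset.prod_const, Finset.prod_filter]
    refine Finset.prod_congr rfl fun j _ => ?_
    split_ifs <;> simp

/-- The root has the maximal number of children, each of which has a subtree in `A`. -/
lemma measure_full_children {N : ℕ} (ν : Measure ℕ) [IsProbabilityMeasure ν]
    {A : Set (List (Fin N) → ℕ)} (hA : MeasurableSet A) :
    envLaw N ν {c | c [] = N ∧ ∀ j : Fin N, shift [j] c ∈ A} = ν {N} * (envLaw N ν A) ^ N := by
  have hind : Measurable (A.indicator (1 : (List (Fin N) → ℕ) → ℝ≥0∞)) :=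
    measurable_one.indicator hA
  have hS : MeasurableSet {c : List (Fin N) → ℕ | c [] = N ∧ ∀ j : Fin N, shift [j] c ∈ A} := by
    refine MeasurableSet.inter (s₁ := {c : List (Fin N) → ℕ | c [] = N})
      ((measurable_pi_apply (X := fun _ : List (Fin N) => ℕ) []) (measurableSet_singleton N)) ?_
    have : {c : List (Fin N) → ℕ | ∀ j : Fin N, shift [j] c ∈ A} = ⋂ j, shift [j] ⁻¹' A := by
      ext; simp
    change MeasurableSet {c : List (Fin N) → ℕ | ∀ j : Fin N, shift [j] c ∈ A}
    rw [this]
    exact .iInter fun j => measurable_shift _ hA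
  have h := lintegral_envLaw_eq (N := N) ν (H := fun k e =>
    ({N} : Set ℕ).indicator 1 k * ∏ j, A.indicator (1 : (List (Fin N) → ℕ) → ℝ≥0∞) (e j))
    fun k => (Finset.measurable_prod _ fun j _ =>
      hind.comp (measurable_pi_apply (X := fun _ : Fin N => List (Fin N) → ℕ) j)).const_mul _
  have hprod : Measurable fun e : Fin N → List (Fin N) → ℕ =>
      ∏ j, A.indicator (1 : (List (Fin N) → ℕ) → ℝ≥0∞) (e j) :=
    Finset.measurable_prod _ fun j _ => hind.comp (measurable_pi_apply j)
  have h2 : ∀ k, ∫⁻ e, ({N} : Set ℕ).indicator 1 k *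
      ∏ j, A.indicator (1 : (List (Fin N) → ℕ) → ℝ≥0∞) (e j)
      ∂(Measure.pi fun _ : Fin N => envLaw N ν) =
      ({N} : Set ℕ).indicator 1 k * (envLaw N ν A) ^ N := by
    intro k
    rw [lintegral_const_mul _ hprod, lintegral_pi_prod _ fun _ => hind]
    simp [lintegral_indicator_one hA]
  simp only [h2] at h
  rw [lintegral_mul_const _ (measurable_one.indicator (measurableSet_singleton N)),
    lintegral_indicator_one (measurableSet_singleton N)] at h
  rw [← h, ← lintegral_indicator_one hS]
  refine lintegral_congr fun c => ?_
  by_cases h1 : c [] = N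
  · by_cases h3 : ∀ j : Fin N, shift [j] c ∈ A
    · simp [Set.indicator, h1, h3]
    · obtain ⟨j, hj⟩ := not_forall.1 h3
      rw [Set.indicator_of_notMem (fun h' => h3 h'.2),
        Finset.prod_eq_zero (Finset.mem_univ j) (by simp [hj]), mul_zero]
  · simp [Set.indicator, h1]

end GWTree

namespace GWTree

/-- The properties of the offspring law that the proofs use. -/
structure IsOffspring (ν : Measure ℕ) (N : ℕ) (m : ℝ) : Prop where
  ae_le : ∀ᵐ k ∂ν, k ∈ (Finset.range (N + 1) : Set ℕ)
  sum_one : ∑ k ∈ Finset.range (N + 1), ν.real {k} = 1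
  mean : ∑ k ∈ Finset.range (N + 1), ν.real {k} * k = m
  top_pos : 0 < ν.real {N}
  one_lt : 1 < m

lemma ae_mem_range {ν : Measure ℕ} {N : ℕ} (hN : IsGreatest {n : ℕ | 0 < ν {n}} N) :
    ∀ᵐ k ∂ν, k ∈ (Finset.range (N + 1) : Set ℕ) := by
  rw [ae_iff_of_countable]
  intro k hk
  have := hN.2 (pos_iff_ne_zero.2 hk : k ∈ {n : ℕ | 0 < ν {n}})
  simp only [Finset.coe_range, Set.mem_Iio]
  omega

lemma isOffspring_of_isGreatest {ν : Measure ℕ} [IsProbabilityMeasure ν] {N : ℕ} {m : ℝ}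
    (hN : IsGreatest {n : ℕ | 0 < ν {n}} N) (hm : m = ∫ n, (n : ℝ) ∂ν) (hm1 : 1 < m) :
    IsOffspring ν N m := by
  have hae := ae_mem_range hN
  have hres := Measure.restrict_eq_self_of_ae_mem hae
  have key : ∀ f : ℕ → ℝ, ∫ n, f n ∂ν = ∑ k ∈ Finset.range (N + 1), ν.real {k} * f k := by
    intro f
    conv_lhs => rw [← hres]
    rw [setIntegral_finset _ IntegrableOn.finset]
    simp
  refine ⟨hae, ?_, ?_, ?_, hm1⟩
  · have := key fun _ => 1
    simpa using this.symm
  · rw [hm, key]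
  · exact ENNReal.toReal_pos (ne_of_gt hN.1) (measure_ne_top _ _)

variable {ν : Measure ℕ} {N : ℕ} {m : ℝ}

lemma IsOffspring.mean_le (h : IsOffspring ν N m) : m ≤ N := by
  rw [← h.mean]
  calc _ ≤ ∑ k ∈ Finset.range (N + 1), ν.real {k} * (N : ℝ) := by
        refine Finset.sum_le_sum fun k hk => mul_le_mul_of_nonneg_left ?_ measureReal_nonneg
        exact_mod_cast Nat.lt_succ_iff.1 (Finset.mem_range.1 hk)
    _ = N := by rw [← Finset.sum_mul, h.sum_one, one_mul]

lemma IsOffspring.two_le (h : IsOffspring ν N m) : 2 ≤ N := by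
  have := h.one_lt.trans_le h.mean_le
  exact_mod_cast this

/-- The generating function of the offspring law as a polynomial function. -/
noncomputable def gf (ν : Measure ℕ) (N : ℕ) (s : ℝ) : ℝ :=
  ∑ k ∈ Finset.range (N + 1), ν.real {k} * s ^ k

lemma gf_nonneg {s : ℝ} (hs : 0 ≤ s) : 0 ≤ gf ν N s :=
  Finset.sum_nonneg fun _ _ => mul_nonneg measureReal_nonneg (pow_nonneg hs _)

lemma gf_mono {s t : ℝ} (hs : 0 ≤ s) (hst : s ≤ t) : gf ν N s ≤ gf ν N t :=
  Finset.sum_le_sum fun _ _ =>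
    mul_le_mul_of_nonneg_left (pow_le_pow_left₀ hs hst _) measureReal_nonneg

lemma gf_iterate_nonneg {s : ℝ} (hs : 0 ≤ s) (g : ℕ) : 0 ≤ (gf ν N)^[g] s := by
  induction g with
  | zero => exact hs
  | succ g ih => rw [Function.iterate_succ_apply']; exact gf_nonneg ih

lemma gf_iterate_mono {s t : ℝ} (hs : 0 ≤ s) (hst : s ≤ t) (g : ℕ) :
    (gf ν N)^[g] s ≤ (gf ν N)^[g] t := by
  induction g with
  | zero => exact hst
  | succ g ih =>
    simp only [Function.iterate_succ_apply']
    exact gf_mono (gf_iterate_nonneg hs g) ih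

lemma card_children {N : ℕ} (k : ℕ) (hk : k ≤ N) : (children (N := N) k).card = k := by
  rw [children, Fin.card_filter_val_lt, min_eq_right hk]

lemma pgf_ofReal [IsProbabilityMeasure ν] (h : IsOffspring ν N m) {s : ℝ} (hs : 0 ≤ s) :
    pgf N ν (ENNReal.ofReal s) = ENNReal.ofReal (gf ν N s) := by
  rw [pgf]
  conv_lhs => rw [← Measure.restrict_eq_self_of_ae_mem h.ae_le]
  rw [lintegral_finset, gf, ENNReal.ofReal_sum_of_nonneg
    fun k _ => mul_nonneg measureReal_nonneg (pow_nonneg hs _)]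
  refine Finset.sum_congr rfl fun k hk => ?_
  rw [card_children k (Nat.lt_succ_iff.1 (Finset.mem_range.1 hk)),
    ENNReal.ofReal_mul measureReal_nonneg, ENNReal.ofReal_pow hs, mul_comm, ofReal_measureReal]

lemma pgf_iterate_ofReal [IsProbabilityMeasure ν] (h : IsOffspring ν N m) {s : ℝ} (hs : 0 ≤ s)
    (g : ℕ) : (pgf N ν)^[g] (ENNReal.ofReal s) = ENNReal.ofReal ((gf ν N)^[g] s) := by
  induction g with
  | zero => rfl
  | succ g ih =>
    simp only [Function.iterate_succ_apply']
    rw [ih, pgf_ofReal h (gf_iterate_nonneg hs g)]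

lemma abs_one_add_pow_sub_le {z : ℝ} (hz : |z| ≤ 1) (k : ℕ) :
    |(1 + z) ^ k - 1 - k * z| ≤ 4 ^ k * z ^ 2 := by
  induction k with
  | zero => simp; positivity
  | succ k ih =>
    have e : (1 + z) ^ (k + 1) - 1 - ((k + 1 : ℕ) : ℝ) * z =
        ((1 + z) ^ k - 1 - k * z) * (1 + z) + k * z ^ 2 := by push_cast; ring
    have h1 : |1 + z| ≤ 2 := by
      have := abs_le.1 hz
      exact abs_le.2 ⟨by linarith, by linarith⟩
    have h2 : (k : ℝ) ≤ 4 ^ k := by exact_mod_cast (Nat.lt_pow_self (by norm_num : 1 < 4)).le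
    rw [e]
    calc _ ≤ |((1 + z) ^ k - 1 - k * z)| * |1 + z| + k * z ^ 2 := by
          refine (abs_add_le _ _).trans ?_
          rw [abs_mul, abs_of_nonneg (by positivity : (0:ℝ) ≤ k * z ^ 2)]
      _ ≤ 4 ^ k * z ^ 2 * 2 + 4 ^ k * z ^ 2 := by gcongr
      _ ≤ 4 ^ (k + 1) * z ^ 2 := by
          have : 0 ≤ (4 : ℝ) ^ k * z ^ 2 := by positivity
          rw [pow_succ (4 : ℝ) k]; linarith

lemma gf_one_add_le (h : IsOffspring ν N m) {z : ℝ} (hz : |z| ≤ 1) :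
    gf ν N (1 + z) ≤ 1 + m * z + 4 ^ N * z ^ 2 := by
  have e : 1 + m * z + 4 ^ N * z ^ 2 =
      ∑ k ∈ Finset.range (N + 1), ν.real {k} * (1 + k * z + 4 ^ N * z ^ 2) := by
    have : ∀ k : ℕ, ν.real {k} * (1 + k * z + 4 ^ N * z ^ 2) =
      ν.real {k} * (1 + 4 ^ N * z ^ 2) + ν.real {k} * k * z := fun k => by ring
    simp only [this, Finset.sum_add_distrib, ← Finset.sum_mul, h.sum_one, h.mean]
    ring
  rw [e, gf]
  refine Finset.sum_le_sum fun k hk => mul_le_mul_of_nonneg_left ?_ measureReal_nonneg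
  have h1 := (abs_le.1 (abs_one_add_pow_sub_le hz k)).2
  have h2 : (4 : ℝ) ^ k * z ^ 2 ≤ 4 ^ N * z ^ 2 := by
    gcongr
    · norm_num
    · exact Nat.lt_succ_iff.1 (Finset.mem_range.1 hk)
  linarith

lemma gf_iterate_le (h : IsOffspring ν N m) {K s x : ℝ} (hK2 : 2 ≤ K)
    (hK : 4 * 4 ^ N ≤ K * (m ^ 2 - m)) (hs : 0 ≤ s) (hsx : s ≤ 1 + x) (g : ℕ)
    (hx : K * |m ^ g * x| ≤ 1) :
    (gf ν N)^[g] s ≤ 1 + m ^ g * x + K * (m ^ g * x) ^ 2 := by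
  have hm := h.one_lt
  induction g with
  | zero =>
    have : 0 ≤ K * x ^ 2 := by positivity
    simp; linarith
  | succ g ih =>
    have hle : |m ^ g * x| ≤ |m ^ (g + 1) * x| := by
      have hmg : 0 < m ^ g := by positivity
      rw [pow_succ, mul_right_comm, abs_mul _ m, abs_of_pos (by linarith : 0 < m)]
      exact le_mul_of_one_le_right (abs_nonneg _) hm.le
    have hy : K * |m ^ g * x| ≤ 1 := le_trans (by gcongr) hx
    have ih' := ih hy
    rw [Function.iterate_succ_apply']
    rw [show m ^ (g + 1) * x = m * (m ^ g * x) by ring]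
    generalize m ^ g * x = y at *
    have ha : 0 ≤ |y| := abs_nonneg y
    have hy2 : 2 * |y| ≤ 1 := by nlinarith
    have hz : |y + K * y ^ 2| ≤ 2 * |y| := by
      refine (abs_add_le _ _).trans ?_
      rw [abs_of_nonneg (by positivity : 0 ≤ K * y ^ 2), ← sq_abs]
      nlinarith
    have hzz : (y + K * y ^ 2) ^ 2 ≤ 4 * y ^ 2 := by
      have := pow_le_pow_left₀ (abs_nonneg _) hz 2
      rwa [sq_abs, mul_pow, sq_abs, show (2 : ℝ) ^ 2 = 4 by norm_num] at this
    have h1 := gf_mono (ν := ν) (N := N) (gf_iterate_nonneg hs g)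
      (ih'.trans_eq (add_assoc 1 y (K * y ^ 2)))
    have h2 := gf_one_add_le h (hz.trans hy2)
    have h3 : (4 : ℝ) ^ N * (y + K * y ^ 2) ^ 2 ≤ 4 ^ N * (4 * y ^ 2) := by gcongr
    have h4 : 4 * 4 ^ N * y ^ 2 ≤ K * (m ^ 2 - m) * y ^ 2 := by gcongr
    nlinarith

lemma IsOffspring.exists_const (h : IsOffspring ν N m) (B : ℝ) :
    ∃ K : ℝ, 2 ≤ K ∧ B ≤ K ∧ 4 * 4 ^ N ≤ K * (m ^ 2 - m) := by
  have hm := h.one_lt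
  have hpos : 0 < m ^ 2 - m := by nlinarith
  refine ⟨max (max 2 B) (4 * 4 ^ N / (m ^ 2 - m)), (le_max_left _ _).trans (le_max_left _ _),
    (le_max_right _ _).trans (le_max_left _ _), ?_⟩
  rw [← div_le_iff₀ hpos]
  exact le_max_right _ _

lemma gf_one (h : IsOffspring ν N m) : gf ν N 1 = 1 := by simp [gf, h.sum_one]

lemma IsOffspring.exists_gf_lt (h : IsOffspring ν N m) :
    ∃ x₀ : ℝ, 0 < x₀ ∧ x₀ < 1 ∧ ∀ x, 0 < x → x ≤ x₀ → gf ν N (1 - x) < 1 - x := by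
  have hm := h.one_lt
  refine ⟨min (1 / 2) ((m - 1) / (2 * 4 ^ N)), ?_, ?_, fun x hx hx0 => ?_⟩
  · have : 0 < m - 1 := by linarith
    positivity
  · exact (min_le_left _ _).trans_lt (by norm_num)
  · have h1 : x ≤ 1 / 2 := hx0.trans (min_le_left _ _)
    have h2 : x ≤ (m - 1) / (2 * 4 ^ N) := hx0.trans (min_le_right _ _)
    rw [le_div_iff₀ (by positivity)] at h2
    have h3 := gf_one_add_le h (z := -x) (by rw [abs_neg, abs_of_pos hx]; linarith)
    rw [← sub_eq_add_neg] at h3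
    nlinarith

lemma convexOn_gf : ConvexOn ℝ (Set.Ici 0) (gf ν N) := by
  have : ∀ s : Finset ℕ, ConvexOn ℝ (Set.Ici (0 : ℝ)) fun t => ∑ k ∈ s, ν.real {k} * t ^ k := by
    intro s
    induction s using Finset.induction_on with
    | empty => simpa using convexOn_const 0 (convex_Ici 0)
    | insert a s ha ih =>
      simp only [Finset.sum_insert ha]
      exact ((convexOn_pow a).smul measureReal_nonneg).add ih
  exact this _

/-- The generating function has at most one fixed point below `1`, and lies strictly below the
diagonal above it. -/
lemma IsOffspring.eq_or_eq_one (h : IsOffspring ν N m) {a b : ℝ} (hb0 : 0 ≤ b) (hba : b ≤ a)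
    (ha1 : a ≤ 1) (hb : gf ν N b = b) (ha : a ≤ gf ν N a) : a = b ∨ a = 1 := by
  by_contra! hne
  have hba' : b < a := lt_of_le_of_ne hba (Ne.symm hne.1)
  have ha1' : a < 1 := lt_of_le_of_ne ha1 hne.2
  obtain ⟨x₀, hx0, hx1, hlt⟩ := h.exists_gf_lt
  set x := min x₀ ((1 - a) / 2) with hx
  have hxpos : 0 < x := lt_min hx0 (by linarith)
  have hxa : a < 1 - x := by
    have := min_le_right x₀ ((1 - a) / 2)
    linarith
  have hfx := hlt x hxpos (min_le_left _ _)
  have hslope := (convexOn_gf (ν := ν) (N := N)).slope_mono_adjacent (x := b) (y := a) (z := 1 - x)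
    hb0 (by simp only [Set.mem_Ici]; linarith) hba' hxa
  rw [hb, div_le_div_iff₀ (by linarith) (by linarith)] at hslope
  nlinarith

end GWTree

namespace GWTree

variable {ν : Measure ℕ} {N : ℕ} {m : ℝ}

lemma lintegral_pow_card_lev [IsProbabilityMeasure ν] (s : ℝ≥0∞) (g : ℕ) :
    ∫⁻ c, s ^ (lev g c).card ∂(envLaw N ν) = (pgf N ν)^[g] s := by
  have := lintegral_levProd (N := N) ν (Y := fun _ => s) measurable_const g
  simpa [levProd] using this

lemma gf_le_pow (h : IsOffspring ν N m) {t : ℝ} (ht : 1 ≤ t) : gf ν N t ≤ t ^ N := by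
  calc gf ν N t ≤ ∑ k ∈ Finset.range (N + 1), ν.real {k} * t ^ N := by
        refine Finset.sum_le_sum fun k hk => mul_le_mul_of_nonneg_left ?_ measureReal_nonneg
        exact pow_le_pow_right₀ ht (Nat.lt_succ_iff.1 (Finset.mem_range.1 hk))
    _ = t ^ N := by rw [← Finset.sum_mul, h.sum_one, one_mul]

lemma gf_iterate_le_pow (h : IsOffspring ν N m) {t : ℝ} (ht : 1 ≤ t) (k : ℕ) :
    (gf ν N)^[k] t ≤ t ^ N ^ k := by
  induction k with
  | zero => simp
  | succ k ih =>
    rw [Function.iterate_succ_apply', pow_succ, pow_mul]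
    exact (gf_mono (gf_iterate_nonneg (by linarith) k) ih).trans (gf_le_pow h (one_le_pow₀ ht))

lemma exp_half_le_one_add {x : ℝ} (h0 : 0 ≤ x) (h1 : x ≤ 1) : Real.exp (x / 2) ≤ 1 + x := by
  have h2 := Real.add_one_le_exp (-(x / 2))
  rw [Real.exp_neg] at h2
  have h3 : 0 < Real.exp (x / 2) := Real.exp_pos _
  have h4 : (-(x / 2) + 1) * Real.exp (x / 2) ≤ 1 := by
    calc _ ≤ (Real.exp (x / 2))⁻¹ * Real.exp (x / 2) := by gcongr
      _ = 1 := inv_mul_cancel₀ h3.ne'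
  have h5 : 1 ≤ (1 + x) * (-(x / 2) + 1) := by nlinarith
  have h6 : 0 < -(x / 2) + 1 := by linarith
  by_contra! hc
  nlinarith

lemma measurable_card_lev (g : ℕ) : Measurable fun c : List (Fin N) → ℕ => (lev g c).card := by
  have h := measurable_levProd (N := N) (Y := fun _ => 2) measurable_const g
  have e : (fun c : List (Fin N) → ℕ => (lev g c).card) =
      fun c => ⌊(Real.logb 2 (levProd (fun _ => 2) g c).toReal)⌋₊ := by
    funext c
    simp [levProd, ENNReal.toReal_pow, Real.logb_pow]
  rw [e]
  exact Nat.measurable_floor.comp (((Real.measurable_log.comp h.ennreal_toReal)).div_const _)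

/-- Large deviations of the generation sizes. -/
lemma IsOffspring.exists_tail_bound [IsProbabilityMeasure ν] (h : IsOffspring ν N m) :
    ∃ A : ℝ, 0 < A ∧ ∀ k g M : ℕ, N ^ k ≤ M →
      envLaw N ν {c | A * M * m ^ g ≤ ((lev (k + g) c).card : ℝ)} ≤
        ENNReal.ofReal ((1 / (4 * N)) ^ M) := by
  obtain ⟨K, hK2, -, hK⟩ := h.exists_const 0
  have hm := h.one_lt
  have hN : (2 : ℝ) ≤ N := by exact_mod_cast h.two_le
  have hA : 0 < 2 * K * Real.log (8 * N) := by
    have := Real.log_pos (by linarith : (1 : ℝ) < 8 * N)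
    positivity
  refine ⟨2 * K * Real.log (8 * N), hA, fun k g M hkM => ?_⟩
  set A := 2 * K * Real.log (8 * N) with hAdef
  have hmg : 1 ≤ m ^ g := one_le_pow₀ hm.le
  set x := K⁻¹ / m ^ g with hx
  have hx0 : 0 < x := by positivity
  have hKi : K⁻¹ ≤ 1 / 2 := by rw [inv_le_comm₀ (by linarith) (by norm_num)]; linarith
  have hx1 : x ≤ 1 := by
    rw [hx, div_le_one (by positivity)]; linarith
  have hmx : m ^ g * x = K⁻¹ := by rw [hx]; field_simp
  have h1 : (gf ν N)^[g] (1 + x) ≤ 2 := by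
    have := gf_iterate_le h hK2 hK (by linarith : 0 ≤ 1 + x) le_rfl g
      (by rw [hmx, abs_of_pos (by positivity)]; exact (mul_inv_cancel₀ (by linarith)).le)
    rw [hmx, show K * K⁻¹ ^ 2 = K⁻¹ by field_simp] at this
    linarith
  have h2 : (gf ν N)^[k + g] (1 + x) ≤ 2 ^ M := by
    rw [Function.iterate_add_apply]
    calc _ ≤ (gf ν N)^[k] 2 := gf_iterate_mono (gf_iterate_nonneg (by linarith) g) h1 k
      _ ≤ 2 ^ N ^ k := gf_iterate_le_pow h (by norm_num) k
      _ ≤ 2 ^ M := pow_le_pow_right₀ (by norm_num) hkM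
  have hE : ∫⁻ c, ENNReal.ofReal (1 + x) ^ (lev (k + g) c).card ∂(envLaw N ν) ≤
      ENNReal.ofReal (2 ^ M) := by
    rw [lintegral_pow_card_lev, pgf_iterate_ofReal h (by linarith)]
    exact ENNReal.ofReal_le_ofReal h2
  have hpos : (0 : ℝ) < (8 * N) ^ M := by positivity
  have hsub : {c : List (Fin N) → ℕ | A * M * m ^ g ≤ ((lev (k + g) c).card : ℝ)} ⊆
      {c : List (Fin N) → ℕ | ENNReal.ofReal ((8 * N) ^ M) ≤ ENNReal.ofReal (1 + x) ^ (lev (k + g) c).card} := by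
    intro c hc
    simp only [Set.mem_ofPred_eq] at hc ⊢
    rw [← ENNReal.ofReal_pow (by linarith)]
    refine ENNReal.ofReal_le_ofReal ?_
    calc ((8 * N : ℝ)) ^ M = Real.exp (M * Real.log (8 * N)) := by
          rw [mul_comm (M : ℝ), Real.exp_mul, Real.exp_log (by linarith), Real.rpow_natCast]
      _ ≤ Real.exp (x / 2 * (lev (k + g) c).card) := by
          refine Real.exp_le_exp.2 ?_
          have : x / 2 * (A * M * m ^ g) = M * Real.log (8 * N) := by
            rw [hAdef, hx]; field_simp
          rw [← this]
          gcongr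
      _ = Real.exp (x / 2) ^ (lev (k + g) c).card := by
          rw [Real.exp_mul, Real.rpow_natCast]
      _ ≤ (1 + x) ^ (lev (k + g) c).card := by
          gcongr
          exact exp_half_le_one_add hx0.le hx1
  refine (measure_mono hsub).trans ?_
  refine (meas_ge_le_lintegral_div ?_ (ENNReal.ofReal_pos.2 hpos).ne' ENNReal.ofReal_ne_top).trans ?_
  · exact ((measurable_from_nat (f := fun k => ENNReal.ofReal (1 + x) ^ k)).comp
      (measurable_card_lev _)).aemeasurable
  · refine (ENNReal.div_le_div_right hE _).trans_eq ?_
    rw [← ENNReal.ofReal_div_of_pos hpos, ← div_pow]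
    congr 2
    field_simp
    norm_num

lemma IsOffspring.log_pos (h : IsOffspring ν N m) : 0 < Real.log N :=
  Real.log_pos (h.one_lt.trans_le h.mean_le)

lemma IsOffspring.log_div_nonneg (h : IsOffspring ν N m) : 0 ≤ Real.log m / Real.log N :=
  div_nonneg (Real.log_nonneg h.one_lt.le) h.log_pos.le

lemma IsOffspring.log_div_le_one (h : IsOffspring ν N m) : Real.log m / Real.log N ≤ 1 := by
  rw [div_le_one h.log_pos]
  exact Real.log_le_log (by linarith [h.one_lt]) h.mean_le

lemma IsOffspring.rpow_log_div (h : IsOffspring ν N m) :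
    (N : ℝ) ^ (Real.log m / Real.log N) = m := by
  have hN : (0 : ℝ) < N := by linarith [h.one_lt, h.mean_le]
  rw [Real.rpow_def_of_pos hN, mul_div_cancel₀ _ h.log_pos.ne', Real.exp_log (by linarith [h.one_lt])]

lemma pow_rpow_comm {x : ℝ} (hx : 0 ≤ x) (k : ℕ) (t : ℝ) : (x ^ k) ^ t = (x ^ t) ^ k := by
  rw [← Real.rpow_natCast, ← Real.rpow_natCast, ← Real.rpow_mul hx, ← Real.rpow_mul hx, mul_comm]

/-- Almost surely, all generations of all subtrees satisfy one upper bound. -/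
lemma IsOffspring.ae_card_lev_le [IsProbabilityMeasure ν] (h : IsOffspring ν N m) :
    ∀ᵐ c ∂(envLaw N ν), ∃ A : ℝ, 0 < A ∧ ∀ (g : ℕ) (v : List (Fin N)),
      ((lev g (shift v c)).card : ℝ) ≤
        A * ((v.length + g + 1 : ℕ) : ℝ) ^ (1 - Real.log m / Real.log N) * m ^ g := by
  obtain ⟨A, hA, hbound⟩ := h.exists_tail_bound
  have hm := h.one_lt
  have hN2 := h.two_le
  have hN : (2 : ℝ) ≤ N := by exact_mod_cast hN2
  set β := Real.log m / Real.log N with hβ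
  have hβ0 : 0 ≤ β := h.log_div_nonneg
  have hβ1 : β ≤ 1 := h.log_div_le_one
  let E : ℕ × ℕ → Set (List (Fin N) → ℕ) := fun p =>
    {c | ∃ v : List.Vector (Fin N) p.1, Nat.log N (p.1 + p.2 + 1) ≤ p.2 ∧
      A * (p.1 + p.2 + 1 : ℕ) * m ^ (p.2 - Nat.log N (p.1 + p.2 + 1)) ≤
        ((lev p.2 (shift v.1 c)).card : ℝ)}
  have hE : ∀ p, envLaw N ν (E p) ≤ ENNReal.ofReal ((1 / 4) ^ (p.1 + p.2 + 1)) := by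
    rintro ⟨n, G⟩
    by_cases hG : Nat.log N (n + G + 1) ≤ G
    swap
    · simp [E, hG]
    have hone : ∀ v : List.Vector (Fin N) n, envLaw N ν
        {c | A * (n + G + 1 : ℕ) * m ^ (G - Nat.log N (n + G + 1)) ≤
          ((lev G (shift v.1 c)).card : ℝ)} ≤ ENNReal.ofReal ((1 / (4 * N)) ^ (n + G + 1)) := by
      intro v
      have h1 := hbound (Nat.log N (n + G + 1)) (G - Nat.log N (n + G + 1)) (n + G + 1)
        (Nat.pow_log_le_self N (by omega))
      rw [Nat.add_sub_cancel' hG] at h1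
      refine le_trans (le_of_eq ?_) h1
      have hmeas : MeasurableSet {c : List (Fin N) → ℕ |
          A * (n + G + 1 : ℕ) * m ^ (G - Nat.log N (n + G + 1)) ≤ ((lev G c).card : ℝ)} :=
        measurableSet_le measurable_const
          ((measurable_from_nat (f := fun k : ℕ => (k : ℝ))).comp (measurable_card_lev G))
      exact (measurePreserving_shift ν v.1).measure_preimage hmeas.nullMeasurableSet
    have hsub : E (n, G) ⊆ ⋃ v : List.Vector (Fin N) n,
        {c | A * (n + G + 1 : ℕ) * m ^ (G - Nat.log N (n + G + 1)) ≤
          ((lev G (shift v.1 c)).card : ℝ)} := by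
      rintro c ⟨v, -, hv⟩
      exact Set.mem_iUnion.2 ⟨v, hv⟩
    calc envLaw N ν (E (n, G)) ≤ _ := measure_mono hsub
      _ ≤ _ := measure_iUnion_fintype_le _ _
      _ ≤ ∑ _v : List.Vector (Fin N) n, ENNReal.ofReal ((1 / (4 * N)) ^ (n + G + 1)) :=
          Finset.sum_le_sum fun v _ => hone v
      _ = ENNReal.ofReal ((N : ℝ) ^ n * (1 / (4 * N)) ^ (n + G + 1)) := by
          rw [ENNReal.ofReal_mul (by positivity)]
          simp [card_vector, ENNReal.ofReal_pow]
      _ ≤ _ := by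
          refine ENNReal.ofReal_le_ofReal ?_
          calc (N : ℝ) ^ n * (1 / (4 * N)) ^ (n + G + 1)
              ≤ (N : ℝ) ^ (n + G + 1) * (1 / (4 * N)) ^ (n + G + 1) := by
                gcongr
                · linarith
                · omega
            _ = (1 / 4) ^ (n + G + 1) := by
                rw [← mul_pow]; congr 1; field_simp
  have hsum : ∑' p, envLaw N ν (E p) ≠ ⊤ := by
    have hs : Summable fun p : ℕ × ℕ => (1 / 4 : ℝ) ^ (p.1 + p.2 + 1) := by
      have hg : Summable fun n : ℕ => (1 / 4 : ℝ) ^ n :=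
        summable_geometric_of_lt_one (by norm_num) (by norm_num)
      have := (hg.mul_of_nonneg hg (fun _ => by positivity) (fun _ => by positivity)).mul_right
        (1 / 4)
      refine this.congr fun p => ?_
      simp only [pow_add, pow_one]
    refine ne_top_of_le_ne_top ?_ (ENNReal.tsum_le_tsum hE)
    rw [← ENNReal.ofReal_tsum_of_nonneg (fun _ => by positivity) hs]
    exact ENNReal.ofReal_ne_top
  filter_upwards [ae_finite_setOfPred_mem hsum] with c hc
  refine ⟨A * m + 1 + ∑ p ∈ hc.toFinset, (N : ℝ) ^ p.2, by positivity, fun g v => ?_⟩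
  set M := v.length + g + 1 with hM
  have hM1 : (1 : ℝ) ≤ M := by rw [hM]; exact_mod_cast Nat.le_add_left 1 _
  have hsum0 : 0 ≤ ∑ p ∈ hc.toFinset, (N : ℝ) ^ p.2 :=
    Finset.sum_nonneg fun _ _ => by positivity
  have hfac : 1 ≤ (M : ℝ) ^ (1 - β) * m ^ g := by
    have h1 := Real.one_le_rpow hM1 (by linarith : 0 ≤ 1 - β)
    have h2 : 1 ≤ m ^ g := one_le_pow₀ hm.le
    nlinarith
  have hcard : ((lev g (shift v c)).card : ℝ) ≤ (N : ℝ) ^ g := by exact_mod_cast card_lev_le _ _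
  suffices hs : ∃ B : ℝ, B ≤ A * m + 1 + ∑ p ∈ hc.toFinset, (N : ℝ) ^ p.2 ∧
      ((lev g (shift v c)).card : ℝ) ≤ B * ((M : ℝ) ^ (1 - β) * m ^ g) by
    obtain ⟨B, hB, hle⟩ := hs
    rw [mul_assoc]
    exact hle.trans (by gcongr)
  by_cases hex : c ∈ E (v.length, g)
  · refine ⟨N ^ g, ?_, hcard.trans (le_mul_of_one_le_right (by positivity) hfac)⟩
    have : (N : ℝ) ^ g ≤ ∑ p ∈ hc.toFinset, (N : ℝ) ^ p.2 :=
      Finset.single_le_sum (f := fun p : ℕ × ℕ => (N : ℝ) ^ p.2) (fun _ _ => by positivity)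
        (hc.mem_toFinset.2 hex)
    have : 0 ≤ A * m := by positivity
    linarith
  have hlogle : N ^ Nat.log N M ≤ M := Nat.pow_log_le_self N (by omega)
  by_cases hg : Nat.log N M ≤ g
  · have hlt : ((lev g (shift v c)).card : ℝ) ≤ A * M * m ^ (g - Nat.log N M) := by
      by_contra! hcon
      exact hex ⟨⟨v, rfl⟩, hg, hcon.le⟩
    refine ⟨A * m, by linarith, hlt.trans ?_⟩
    have h1 : (M : ℝ) ^ β ≤ m ^ (Nat.log N M + 1) := by
      have : (M : ℝ) ≤ (N : ℝ) ^ (Nat.log N M + 1) := by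
        exact_mod_cast (Nat.lt_pow_succ_log_self hN2 M).le
      calc (M : ℝ) ^ β ≤ ((N : ℝ) ^ (Nat.log N M + 1)) ^ β := by gcongr
        _ = m ^ (Nat.log N M + 1) := by rw [pow_rpow_comm (by linarith), h.rpow_log_div]
    have h2 : (M : ℝ) = (M : ℝ) ^ (1 - β) * (M : ℝ) ^ β := by
      rw [← Real.rpow_add (by linarith)]; simp
    have h3 : m ^ g = m ^ (g - Nat.log N M) * m ^ Nat.log N M := by
      rw [← pow_add, Nat.sub_add_cancel hg]
    calc A * M * m ^ (g - Nat.log N M)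
        = A * ((M : ℝ) ^ (1 - β) * (M : ℝ) ^ β) * m ^ (g - Nat.log N M) := by rw [← h2]
      _ ≤ A * ((M : ℝ) ^ (1 - β) * m ^ (Nat.log N M + 1)) * m ^ (g - Nat.log N M) := by gcongr
      _ = A * m * ((M : ℝ) ^ (1 - β) * m ^ g) := by rw [h3]; ring
  · refine ⟨1, ?_, ?_⟩
    · have : 0 ≤ A * m := by positivity
      linarith
    have h1 : (N : ℝ) ^ g ≤ M := by
      exact_mod_cast (Nat.pow_le_pow_right (by omega) (not_le.1 hg).le).trans hlogle
    calc ((lev g (shift v c)).card : ℝ) ≤ (N : ℝ) ^ g := hcard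
      _ = ((N : ℝ) ^ g) ^ (1 - β) * ((N : ℝ) ^ g) ^ β := by
          rw [← Real.rpow_add (by positivity)]; simp
      _ = ((N : ℝ) ^ g) ^ (1 - β) * m ^ g := by
          rw [pow_rpow_comm (by linarith) g β, h.rpow_log_div]
      _ ≤ (M : ℝ) ^ (1 - β) * m ^ g := by
          gcongr
      _ = _ := (one_mul _).symm

end GWTree

namespace GWTree

variable {ν : Measure ℕ} {N : ℕ} {m : ℝ}

lemma measurableSet_alive : MeasurableSet {c : List (Fin N) → ℕ | Alive c} := by
  have : {c : List (Fin N) → ℕ | Alive c} = ⋂ k, {c | 0 < (lev k c).card} := by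
    ext c; simp [Alive, Finset.card_pos]
  rw [this]
  exact .iInter fun k => measurableSet_lt measurable_const (measurable_card_lev k)

lemma measure_lev_eq_empty [IsProbabilityMeasure ν] (h : IsOffspring ν N m) (k : ℕ) :
    envLaw N ν {c | lev k c = ∅} = ENNReal.ofReal ((gf ν N)^[k] 0) := by
  rw [← pgf_iterate_ofReal h le_rfl, ENNReal.ofReal_zero, ← lintegral_pow_card_lev,
    ← lintegral_indicator_one]
  · refine lintegral_congr fun c => ?_
    by_cases hc : lev k c = ∅
    · simp [hc]
    · rw [zero_pow (by simpa using hc)]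
      simp [hc]
  · have : {c : List (Fin N) → ℕ | lev k c = ∅} = {c | (lev k c).card = 0} := by
      ext; simp
    rw [this]
    exact measurable_card_lev k (measurableSet_singleton 0)

lemma IsOffspring.alive_pos [IsProbabilityMeasure ν] (h : IsOffspring ν N m) :
    0 < (envLaw N ν).real {c | Alive c} := by
  obtain ⟨x, hx0, hx1, hx⟩ := h.exists_gf_lt
  have hit : ∀ k, (gf ν N)^[k] 0 ≤ 1 - x := by
    intro k
    induction k with
    | zero => simp; linarith
    | succ k ih =>
      rw [Function.iterate_succ_apply']
      exact (gf_mono (gf_iterate_nonneg le_rfl k) ih).trans (hx x hx0 le_rfl).le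
  have hU : {c : List (Fin N) → ℕ | Alive c}ᶜ = ⋃ k, {c | lev k c = ∅} := by
    ext c; simp [Alive, Finset.not_nonempty_iff_eq_empty]
  have hmono : Monotone fun k => {c : List (Fin N) → ℕ | lev k c = ∅} := by
    intro k l hkl c hc
    simp only [Set.mem_ofPred_eq, ← Finset.not_nonempty_iff_eq_empty] at hc ⊢
    exact fun hl => hc (lev_nonempty_of_le hkl hl)
  have hle : envLaw N ν {c | Alive c}ᶜ ≤ ENNReal.ofReal (1 - x) := by
    rw [hU, hmono.measure_iUnion]
    refine iSup_le fun k => ?_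
    rw [measure_lev_eq_empty h]
    exact ENNReal.ofReal_le_ofReal (hit k)
  have h2 : (envLaw N ν).real {c | Alive c}ᶜ ≤ 1 - x :=
    ENNReal.toReal_le_of_le_ofReal (by linarith) hle
  rw [probReal_compl_eq_one_sub measurableSet_alive] at h2
  linarith

open Classical in
lemma levProd_ite (w : ℝ≥0∞) (g : ℕ) (c : List (Fin N) → ℕ) :
    levProd (fun c => if Alive c then w else 1) g c = w ^ (aliveLev g c).card := by
  rw [levProd, aliveLev, ← Finset.prod_const, Finset.prod_filter]

lemma measurable_card_aliveLev (g : ℕ) :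
    Measurable fun c : List (Fin N) → ℕ => (aliveLev g c).card := by
  classical
  have h := measurable_levProd (N := N) (Y := fun c => if Alive c then 2 else 1)
    (Measurable.ite measurableSet_alive measurable_const measurable_const) g
  have e : (fun c : List (Fin N) → ℕ => (aliveLev g c).card) = fun c =>
      ⌊(Real.logb 2 (levProd (fun c => if Alive c then 2 else 1) g c).toReal)⌋₊ := by
    funext c
    simp [levProd_ite, ENNReal.toReal_pow, Real.logb_pow]
  rw [e]
  exact Nat.measurable_floor.comp (((Real.measurable_log.comp h.ennreal_toReal)).div_const _)

lemma measurableSet_le_card_aliveLev (T : ℝ) (g : ℕ) :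
    MeasurableSet {c : List (Fin N) → ℕ | T ≤ ((aliveLev g c).card : ℝ)} :=
  measurableSet_le measurable_const
    ((measurable_from_nat (f := fun k : ℕ => (k : ℝ))).comp (measurable_card_aliveLev g))

lemma card_aliveLev_le (g : ℕ) (c : List (Fin N) → ℕ) :
    (aliveLev g c).card ≤ (lev g c).card := by
  classical exact Finset.card_filter_le _ _

open Classical in
lemma card_aliveLev_succ (g : ℕ) (c : List (Fin N) → ℕ) :
    (aliveLev (g + 1) c).card = ∑ j ∈ children (c []), (aliveLev g (shift [j] c)).card := by
  rw [aliveLev, Finset.card_filter, sum_lev_succ]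
  refine Finset.sum_congr rfl fun j _ => ?_
  rw [aliveLev, Finset.card_filter]
  simp only [shift_shift, List.singleton_append]

lemma lintegral_ite_const {E : Type*} [MeasurableSpace E] (μ : Measure E) [IsProbabilityMeasure μ]
    {A : Set E} (hA : MeasurableSet A) [DecidablePred (· ∈ A)] {a b : ℝ} (ha : 0 ≤ a) (hb : 0 ≤ b) :
    ∫⁻ e, (if e ∈ A then ENNReal.ofReal a else ENNReal.ofReal b) ∂μ =
      ENNReal.ofReal (a * μ.real A + b * (1 - μ.real A)) := by
  rw [← lintegral_add_compl _ hA]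
  rw [setLIntegral_congr_fun (g := fun _ => ENNReal.ofReal a) hA (fun e he => if_pos he),
    setLIntegral_congr_fun (g := fun _ => ENNReal.ofReal b) hA.compl (fun e he => if_neg he),
    setLIntegral_const, setLIntegral_const, ← probReal_compl_eq_one_sub hA,
    ENNReal.ofReal_add (by positivity) (by positivity), ENNReal.ofReal_mul ha,
    ENNReal.ofReal_mul hb, ofReal_measureReal, ofReal_measureReal]

/-- With uniformly positive probability a generation has its typical size. -/
lemma IsOffspring.exists_typical [IsProbabilityMeasure ν] (h : IsOffspring ν N m) :
    ∃ c₀ δ : ℝ, 0 < c₀ ∧ c₀ ≤ 1 ∧ 0 < δ ∧ ∀ g,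
      δ ≤ (envLaw N ν).real {c | c₀ * m ^ g ≤ ((aliveLev g c).card : ℝ)} := by
  classical
  set σ := (envLaw N ν).real {c | Alive c} with hσ
  have hσ0 : 0 < σ := h.alive_pos
  have hσ1 : σ ≤ 1 := measureReal_le_one
  obtain ⟨K, hK2, hKσ, hK⟩ := h.exists_const σ⁻¹
  have hm := h.one_lt
  have hKσ' : 1 ≤ K * σ := by
    rw [inv_le_iff_one_le_mul₀ hσ0] at hKσ; linarith
  refine ⟨σ / 4, 1 / (8 * K), by positivity, by linarith, by positivity, fun g => ?_⟩
  have hmg : 1 ≤ m ^ g := one_le_pow₀ hm.le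
  set ε := 1 / (2 * K * σ * m ^ g) with hε
  have hε0 : 0 < ε := by positivity
  have hε1 : ε ≤ 1 := by
    rw [hε, div_le_one (by positivity)]
    nlinarith
  have hy : m ^ g * (-(σ * ε)) = -(1 / (2 * K)) := by
    rw [hε]; field_simp
  have hu : 1 / (8 * K) ≤ 1 / 16 := one_div_le_one_div_of_le (by norm_num) (by linarith)
  have hE : ∫⁻ c, ENNReal.ofReal (1 - ε) ^ (aliveLev g c).card ∂(envLaw N ν) ≤
      ENNReal.ofReal (1 - 2 * (1 / (8 * K))) := by
    simp only [← levProd_ite]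
    rw [lintegral_levProd ν
      (Measurable.ite measurableSet_alive measurable_const measurable_const)]
    have h1 := lintegral_ite_const (envLaw N ν) measurableSet_alive (a := 1 - ε) (b := 1)
      (by linarith) zero_le_one
    simp only [Set.mem_ofPred_eq, ENNReal.ofReal_one] at h1
    rw [h1, show (1 - ε) * σ + 1 * (1 - σ) = 1 + -(σ * ε) by ring]
    have h0 : 0 ≤ 1 + -(σ * ε) := by nlinarith
    rw [pgf_iterate_ofReal h h0]
    refine ENNReal.ofReal_le_ofReal ?_
    refine (gf_iterate_le h hK2 hK h0 le_rfl g ?_).trans ?_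
    · rw [hy, abs_neg, abs_of_pos (by positivity)]
      field_simp; norm_num
    · rw [hy]
      apply le_of_eq
      field_simp; ring
  set p := (envLaw N ν).real {c | ((aliveLev g c).card : ℝ) < σ / 4 * m ^ g} with hp
  have hms : MeasurableSet {c : List (Fin N) → ℕ | ((aliveLev g c).card : ℝ) < σ / 4 * m ^ g} := by
    have := (measurableSet_le_card_aliveLev (N := N) (σ / 4 * m ^ g) g).compl
    convert this using 1
    ext; simp
  have hmarkov : ENNReal.ofReal (1 - 1 / (8 * K)) *
      envLaw N ν {c | ((aliveLev g c).card : ℝ) < σ / 4 * m ^ g} ≤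
      ENNReal.ofReal (1 - 2 * (1 / (8 * K))) := by
    refine le_trans ?_ hE
    rw [← setLIntegral_const]
    refine le_trans ?_ (setLIntegral_le_lintegral {c | ((aliveLev g c).card : ℝ) < σ / 4 * m ^ g} _)
    refine setLIntegral_mono_ae' hms (ae_of_all _ fun c hc => ?_)
    rw [← ENNReal.ofReal_pow (by linarith)]
    refine ENNReal.ofReal_le_ofReal ?_
    have hb := one_add_mul_le_pow (a := -ε) (by linarith) (aliveLev g c).card
    rw [← sub_eq_add_neg] at hb
    refine le_trans ?_ hb
    have h2 : ((aliveLev g c).card : ℝ) * ε ≤ σ / 4 * m ^ g * ε := by gcongr; exact hc.le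
    have h3 : σ / 4 * m ^ g * ε = 1 / (8 * K) := by
      rw [hε]; field_simp; norm_num
    linarith
  have hreal : (1 - 1 / (8 * K)) * p ≤ 1 - 2 * (1 / (8 * K)) := by
    have := ENNReal.toReal_mono ENNReal.ofReal_ne_top hmarkov
    rwa [ENNReal.toReal_mul, ENNReal.toReal_ofReal (by linarith),
      ENNReal.toReal_ofReal (by linarith)] at this
  have hcompl : {c : List (Fin N) → ℕ | σ / 4 * m ^ g ≤ ((aliveLev g c).card : ℝ)} =
      {c | ((aliveLev g c).card : ℝ) < σ / 4 * m ^ g}ᶜ := by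
    ext; simp
  rw [hcompl, probReal_compl_eq_one_sub hms]
  have hu0 : 0 < 1 / (8 * K) := by positivity
  nlinarith

lemma IsOffspring.le_measure_full [IsProbabilityMeasure ν] (h : IsOffspring ν N m) {η T : ℝ}
    {g : ℕ} (h0 : 0 ≤ η) (h1 : η ≤ 1) (hp : η ≤ ν.real {N})
    (hT : η ≤ (envLaw N ν).real {c | T ≤ ((aliveLev g c).card : ℝ)}) (k : ℕ) :
    η ^ (2 * N ^ k) ≤
      η * (envLaw N ν).real {c | N ^ k * T ≤ ((aliveLev (k + g) c).card : ℝ)} := by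
  induction k with
  | zero =>
    simp only [pow_zero, mul_one, one_mul, zero_add, pow_two]
    gcongr
  | succ k ih =>
    set A := {c : List (Fin N) → ℕ | N ^ k * T ≤ ((aliveLev (k + g) c).card : ℝ)} with hA
    have hmA : MeasurableSet A := measurableSet_le_card_aliveLev _ _
    have hsub : {c : List (Fin N) → ℕ | c [] = N ∧ ∀ j : Fin N, shift [j] c ∈ A} ⊆
        {c | N ^ (k + 1) * T ≤ ((aliveLev (k + 1 + g) c).card : ℝ)} := by
      rintro c ⟨hc, hj⟩
      have hch : children (N := N) N = Finset.univ := by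
        ext j; simp [children]
      simp only [Set.mem_ofPred_eq]
      rw [show k + 1 + g = (k + g) + 1 by ring, card_aliveLev_succ, hc, hch]
      push_cast
      calc (N : ℝ) ^ (k + 1) * T = ∑ _j : Fin N, (N : ℝ) ^ k * T := by simp; ring
        _ ≤ _ := Finset.sum_le_sum fun j _ => hj j
    have hle : ν.real {N} * (envLaw N ν).real A ^ N ≤
        (envLaw N ν).real {c | N ^ (k + 1) * T ≤ ((aliveLev (k + 1 + g) c).card : ℝ)} := by
      have := ENNReal.toReal_mono (measure_ne_top _ _) ((measure_full_children ν hmA).symm.le.trans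
        (measure_mono hsub))
      rwa [ENNReal.toReal_mul, ENNReal.toReal_pow] at this
    have hq : 0 ≤ (envLaw N ν).real A := measureReal_nonneg
    calc η ^ (2 * N ^ (k + 1)) = (η ^ (2 * N ^ k)) ^ N := by rw [← pow_mul]; ring_nf
      _ ≤ (η * (envLaw N ν).real A) ^ N := by gcongr
      _ = η ^ N * (envLaw N ν).real A ^ N := mul_pow _ _ _
      _ ≤ η ^ 2 * (envLaw N ν).real A ^ N := by
          exact mul_le_mul_of_nonneg_right (pow_le_pow_of_le_one h0 h1 h.two_le) (by positivity)
      _ = η * (η * (envLaw N ν).real A ^ N) := by ring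
      _ ≤ η * (ν.real {N} * (envLaw N ν).real A ^ N) := by gcongr
      _ ≤ _ := by gcongr

/-- A lower bound for the probability that a tree is full for `k` generations and typical
afterwards. -/
lemma IsOffspring.exists_great [IsProbabilityMeasure ν] (h : IsOffspring ν N m) :
    ∃ c₀ η : ℝ, 0 < c₀ ∧ 0 < η ∧ η ≤ 1 ∧ ∀ k g : ℕ, η ^ (2 * N ^ k) ≤ (envLaw N ν).real
      {c | c₀ * N ^ (min k g) * m ^ (g - min k g) ≤ ((aliveLev g c).card : ℝ)} := by
  obtain ⟨c₀, δ, hc0, -, hδ, hb⟩ := h.exists_typical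
  refine ⟨c₀, min δ (ν.real {N}), hc0, lt_min hδ h.top_pos,
    (min_le_right _ _).trans measureReal_le_one, fun k g => ?_⟩
  set η := min δ (ν.real {N})
  have hη0 : 0 < η := lt_min hδ h.top_pos
  have hη1 : η ≤ 1 := (min_le_right _ _).trans measureReal_le_one
  have h1 := h.le_measure_full hη0.le hη1 (min_le_right _ _)
    ((min_le_left _ _).trans (hb (g - min k g))) (min k g)
  rw [Nat.add_sub_cancel' (min_le_right k g)] at h1
  have hN := h.two_le
  calc η ^ (2 * N ^ k) ≤ η ^ (2 * N ^ min k g) := by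
        refine pow_le_pow_of_le_one hη0.le hη1 ?_
        exact Nat.mul_le_mul_left 2 (Nat.pow_le_pow_right (by omega) (min_le_left _ _))
    _ ≤ _ := h1
    _ ≤ 1 * _ := by gcongr
    _ = _ := by
        rw [one_mul]
        congr 3
        ext c
        rw [mul_left_comm, mul_assoc]

end GWTree

namespace GWTree

variable {ν : Measure ℕ} {N : ℕ} {m : ℝ}

/-- Infinitely many generations have at least the typical size, up to a constant. -/
def Regular (m : ℝ) (c : List (Fin N) → ℕ) : Prop :=
  ∃ j : ℕ, ∀ k, ∃ l, k ≤ l ∧ m ^ l ≤ j * ((lev l c).card : ℝ)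

lemma measurableSet_regular : MeasurableSet {c : List (Fin N) → ℕ | Regular m c} := by
  have : {c : List (Fin N) → ℕ | Regular m c} =
      ⋃ j : ℕ, ⋂ k : ℕ, ⋃ l : ℕ, {c | k ≤ l ∧ m ^ l ≤ j * ((lev l c).card : ℝ)} := by
    ext c; simp [Regular]
  rw [this]
  refine .iUnion fun j => .iInter fun k => .iUnion fun l => ?_
  by_cases hkl : k ≤ l
  · simp only [hkl, true_and]
    exact measurableSet_le measurable_const
      ((measurable_from_nat (f := fun i : ℕ => (j : ℝ) * i)).comp (measurable_card_lev l))
  · simp [hkl]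

lemma card_lev_child_le {c : List (Fin N) → ℕ} {j : Fin N} (hj : (j : ℕ) < c []) (l : ℕ) :
    (lev l (shift [j] c)).card ≤ (lev (l + 1) c).card := by
  rw [← Finset.card_map ⟨List.cons j, List.cons_injective⟩]
  refine Finset.card_le_card fun w hw => ?_
  obtain ⟨u, hu, rfl⟩ := Finset.mem_map.1 hw
  exact mem_lev_succ.2 ⟨j, hj, u, hu, rfl⟩

lemma Regular.of_child (hm : 1 < m) {c : List (Fin N) → ℕ} {j : Fin N} (hj : (j : ℕ) < c [])
    (h : Regular m (shift [j] c)) : Regular m c := by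
  obtain ⟨i, hi⟩ := h
  refine ⟨⌈m⌉₊ * i, fun k => ?_⟩
  obtain ⟨l, hkl, hl⟩ := hi k
  refine ⟨l + 1, by omega, ?_⟩
  have h1 : ((lev l (shift [j] c)).card : ℝ) ≤ (lev (l + 1) c).card := by
    exact_mod_cast card_lev_child_le hj l
  calc m ^ (l + 1) = m * m ^ l := by ring
    _ ≤ ⌈m⌉₊ * (i * (lev l (shift [j] c)).card) := by
        gcongr
        exact Nat.le_ceil m
    _ ≤ ⌈m⌉₊ * (i * (lev (l + 1) c).card) := by gcongr
    _ = _ := by push_cast; ring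

lemma Regular.alive (hm : 1 < m) {c : List (Fin N) → ℕ} (h : Regular m c) : Alive c := by
  obtain ⟨j, hj⟩ := h
  intro k
  obtain ⟨l, hkl, hl⟩ := hj k
  refine lev_nonempty_of_le hkl (Finset.card_pos.1 (Nat.pos_of_ne_zero fun h0 => ?_))
  rw [h0] at hl
  have : 0 < m ^ l := by positivity
  simp at hl
  linarith

lemma measure_frequently_ge {E : Type*} [MeasurableSpace E] {μ : Measure E} [IsFiniteMeasure μ]
    {s : ℕ → Set E} (hs : ∀ n, MeasurableSet (s n)) {δ : ℝ≥0∞} (h : ∀ n, δ ≤ μ (s n)) :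
    δ ≤ μ {x | ∀ k, ∃ l, k ≤ l ∧ x ∈ s l} := by
  have e : {x | ∀ k, ∃ l, k ≤ l ∧ x ∈ s l} = ⋂ k, ⋃ l ∈ Set.Ici k, s l := by
    ext x; simp
  have hanti : Antitone fun k : ℕ => ⋃ l ∈ Set.Ici k, s l := fun k k' hk =>
    Set.biUnion_subset_biUnion_left (Set.Ici_subset_Ici.2 hk)
  rw [e, hanti.measure_iInter
    (fun k => (MeasurableSet.biUnion (Set.to_countable _) fun l _ => hs l).nullMeasurableSet)
    ⟨0, measure_ne_top _ _⟩]
  exact le_iInf fun k => (h k).trans (measure_mono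
    (Set.subset_biUnion_of_mem (u := s) (Set.mem_Ici.2 le_rfl)))

lemma IsOffspring.regular_pos [IsProbabilityMeasure ν] (h : IsOffspring ν N m) :
    0 < (envLaw N ν).real {c | Regular m c} := by
  obtain ⟨c₀, δ, hc0, -, hδ, hb⟩ := h.exists_typical
  have hm := h.one_lt
  set j := ⌈c₀⁻¹⌉₊
  have hj : c₀⁻¹ ≤ j := Nat.le_ceil _
  have h1 := measure_frequently_ge (μ := envLaw N ν)
    (s := fun g => {c : List (Fin N) → ℕ | c₀ * m ^ g ≤ ((aliveLev g c).card : ℝ)})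
    (fun g => measurableSet_le_card_aliveLev _ g) (δ := ENNReal.ofReal δ)
    (fun g => ENNReal.ofReal_le_of_le_toReal (hb g))
  have hsub : {c : List (Fin N) → ℕ | ∀ k, ∃ l, k ≤ l ∧
      c ∈ {c : List (Fin N) → ℕ | c₀ * m ^ l ≤ ((aliveLev l c).card : ℝ)}} ⊆
      {c | Regular m c} := by
    intro c hc
    refine ⟨j, fun k => ?_⟩
    obtain ⟨l, hkl, hl⟩ := hc k
    refine ⟨l, hkl, ?_⟩
    have h2 : ((aliveLev l c).card : ℝ) ≤ (lev l c).card := by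
      exact_mod_cast card_aliveLev_le l c
    calc m ^ l = c₀⁻¹ * (c₀ * m ^ l) := by field_simp
      _ ≤ j * (lev l c).card := by
          gcongr
          exact le_trans hl h2
  have h2 := h1.trans (measure_mono hsub)
  exact ENNReal.toReal_pos ((ENNReal.ofReal_pos.2 hδ).trans_le h2).ne' (measure_ne_top _ _)

lemma levProd_one_indicator (A : Set (List (Fin N) → ℕ)) (c : List (Fin N) → ℕ)
    [Decidable (∀ j : Fin N, (j : ℕ) < c [] → shift [j] c ∈ A)] :
    levProd (A.indicator 1) 1 c =
      if ∀ j : Fin N, (j : ℕ) < c [] → shift [j] c ∈ A then 1 else 0 := by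
  rw [levProd_succ]
  split_ifs with h
  · refine Finset.prod_eq_one fun j _ => ?_
    split_ifs with hj
    · simp [levProd_zero, h j hj]
    · rfl
  · push Not at h
    obtain ⟨j, hj, hjA⟩ := h
    exact Finset.prod_eq_zero (Finset.mem_univ j) (by simp [levProd_zero, hj, hjA])

lemma lintegral_levProd_one_indicator [IsProbabilityMeasure ν] (h : IsOffspring ν N m)
    {A : Set (List (Fin N) → ℕ)} (hA : MeasurableSet A) :
    ∫⁻ c, levProd (A.indicator 1) 1 c ∂(envLaw N ν) =
      ENNReal.ofReal (gf ν N ((envLaw N ν).real A)) := by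
  rw [lintegral_levProd ν (measurable_one.indicator hA), lintegral_indicator_one hA,
    Function.iterate_one, ← pgf_ofReal h measureReal_nonneg, ofReal_measureReal]

/-- Almost every surviving tree is regular. -/
lemma IsOffspring.ae_regular_of_alive [IsProbabilityMeasure ν] (h : IsOffspring ν N m) :
    ∀ᵐ c ∂(envLaw N ν), Alive c → Regular m c := by
  classical
  have hm := h.one_lt
  set D := {c : List (Fin N) → ℕ | Alive c}ᶜ with hD
  set A := {c : List (Fin N) → ℕ | Regular m c}ᶜ with hA
  have hmD : MeasurableSet D := measurableSet_alive.compl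
  have hmA : MeasurableSet A := measurableSet_regular.compl
  have hDA : D ⊆ A := fun c hc hr => hc (hr.alive hm)
  have hfD : gf ν N ((envLaw N ν).real D) = (envLaw N ν).real D := by
    have h1 := lintegral_levProd_one_indicator h hmD
    have h2 : ∀ c, levProd (D.indicator 1) 1 c = D.indicator 1 c := by
      intro c
      rw [levProd_one_indicator, Set.indicator_apply]
      refine if_congr ?_ rfl rfl
      constructor
      · intro hj hc
        obtain ⟨j, hj', hjc⟩ := Alive.exists_child hc
        exact hj j hj' hjc
      · exact fun hc j hj hjc => hc (alive_of_child hj hjc)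
    simp only [h2] at h1
    rw [lintegral_indicator_one hmD] at h1
    have h3 := congrArg ENNReal.toReal h1
    rw [ENNReal.toReal_ofReal (gf_nonneg measureReal_nonneg)] at h3
    exact h3.symm
  have hfA : (envLaw N ν).real A ≤ gf ν N ((envLaw N ν).real A) := by
    refine ENNReal.toReal_le_of_le_ofReal (gf_nonneg measureReal_nonneg) ?_
    rw [← lintegral_levProd_one_indicator h hmA, ← lintegral_indicator_one hmA]
    refine lintegral_mono fun c => ?_
    rw [levProd_one_indicator]
    by_cases hc : c ∈ A
    · rw [if_pos (show ∀ j : Fin N, (j : ℕ) < c [] → shift [j] c ∈ A from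
        fun j hj hjc => hc (Regular.of_child hm hj hjc))]
      simp [hc]
    · simp [hc]
  have hA1 : (envLaw N ν).real A < 1 := by
    rw [hA, probReal_compl_eq_one_sub measurableSet_regular]
    linarith [h.regular_pos]
  rcases h.eq_or_eq_one measureReal_nonneg (measureReal_mono hDA) measureReal_le_one hfD hfA
    with heq | heq
  swap
  · exact absurd heq hA1.ne
  have h0 : envLaw N ν (A \ D) = 0 := by
    have := measureReal_sdiff (μ := envLaw N ν) hDA hmD
    rw [heq, sub_self] at this
    exact (measureReal_eq_zero_iff).1 this
  rw [ae_iff]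
  refine measure_mono_null (fun c hc => ?_) h0
  simp only [Set.mem_ofPred_eq, Classical.not_imp] at hc
  exact ⟨hc.2, fun hn => hn hc.1⟩

/-- A large generation is unlikely to contain no node with a subtree in `G`. -/
lemma measure_large_without_le [IsProbabilityMeasure ν] (h : IsOffspring ν N m)
    {G : Set (List (Fin N) → ℕ)} (hG : MeasurableSet G) {p M : ℝ} (hp0 : 0 ≤ p)
    (hp : p ≤ (envLaw N ν).real G) (n : ℕ) :
    envLaw N ν {c | M ≤ ((lev n c).card : ℝ) ∧ ∀ v ∈ lev n c, shift v c ∉ G} ≤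
      ENNReal.ofReal (Real.exp (-(p * M / 2))) := by
  classical
  have hp1 : p ≤ 1 := hp.trans measureReal_le_one
  have hmeas : Measurable fun c : List (Fin N) → ℕ =>
      if c ∈ G then ENNReal.ofReal 0 else ENNReal.ofReal (1 + p) :=
    Measurable.ite hG measurable_const measurable_const
  have hE : ∫⁻ c, levProd (fun c => if c ∈ G then ENNReal.ofReal 0 else ENNReal.ofReal (1 + p)) n c
      ∂(envLaw N ν) ≤ 1 := by
    have hle : (0 : ℝ) * (envLaw N ν).real G + (1 + p) * (1 - (envLaw N ν).real G) ≤ 1 := by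
      nlinarith
    have h0 : 0 ≤ (0 : ℝ) * (envLaw N ν).real G + (1 + p) * (1 - (envLaw N ν).real G) := by
      have : (envLaw N ν).real G ≤ 1 := measureReal_le_one
      have : 0 ≤ (1 + p) * (1 - (envLaw N ν).real G) := mul_nonneg (by linarith) (by linarith)
      linarith
    rw [lintegral_levProd ν hmeas, lintegral_ite_const _ hG le_rfl (by linarith),
      pgf_iterate_ofReal h h0, ENNReal.ofReal_le_one]
    refine (gf_iterate_mono h0 hle n).trans_eq ?_
    exact Function.iterate_fixed (gf_one h) n
  have hsub : {c : List (Fin N) → ℕ | M ≤ ((lev n c).card : ℝ) ∧ ∀ v ∈ lev n c, shift v c ∉ G} ⊆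
      {c : List (Fin N) → ℕ | ENNReal.ofReal (Real.exp (p * M / 2)) ≤
        levProd (fun c => if c ∈ G then ENNReal.ofReal 0 else ENNReal.ofReal (1 + p)) n c} := by
    rintro c ⟨hM, hv⟩
    have : levProd (fun c => if c ∈ G then ENNReal.ofReal 0 else ENNReal.ofReal (1 + p)) n c =
        ENNReal.ofReal (1 + p) ^ (lev n c).card := by
      rw [levProd, ← Finset.prod_const]
      exact Finset.prod_congr rfl fun v hv' => if_neg (hv v hv')
    simp only [Set.mem_ofPred_eq]
    rw [this, ← ENNReal.ofReal_pow (by linarith)]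
    refine ENNReal.ofReal_le_ofReal ?_
    calc Real.exp (p * M / 2) ≤ Real.exp (p / 2 * (lev n c).card) := by
          refine Real.exp_le_exp.2 ?_
          rw [mul_div_right_comm]
          gcongr
      _ = Real.exp (p / 2) ^ (lev n c).card := by rw [Real.exp_mul, Real.rpow_natCast]
      _ ≤ _ := by
          gcongr
          exact exp_half_le_one_add hp0 hp1
  have hpos := Real.exp_pos (p * M / 2)
  refine (measure_mono hsub).trans ?_
  refine (meas_ge_le_lintegral_div (measurable_levProd hmeas n).aemeasurable
    (ENNReal.ofReal_pos.2 hpos).ne' ENNReal.ofReal_ne_top).trans ?_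
  refine (ENNReal.div_le_div_right hE _).trans_eq ?_
  rw [Real.exp_neg, ENNReal.ofReal_inv_of_pos hpos, one_div]

lemma summable_sq_mul_exp_neg_div {r : ℝ} (hr : 1 < r) :
    Summable fun n : ℕ => ((n : ℝ) ^ 2 + 1) * Real.exp (-(r ^ n / (2 * (n + 1)))) := by
  have h1 : ∀ᶠ n : ℕ in atTop, (n : ℝ) * (2 * (n + 1)) ≤ r ^ n := by
    have h2 := (tendsto_pow_const_div_const_pow_of_one_lt 2 hr).eventually
      (gt_mem_nhds (by norm_num : (0 : ℝ) < 1 / 4))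
    filter_upwards [h2, eventually_ge_atTop 1] with n hn hn1
    have hpos : 0 < r ^ n := by positivity
    rw [div_lt_iff₀ hpos] at hn
    have : (1 : ℝ) ≤ n := by exact_mod_cast hn1
    nlinarith
  have hs : Summable fun n : ℕ => (n : ℝ) ^ 2 * Real.exp (-1) ^ n +
      Real.exp (-1) ^ n := by
    have he : Real.exp (-1) < 1 := by
      rw [← Real.exp_zero]; exact Real.exp_lt_exp.2 (by norm_num)
    have hn : ‖Real.exp (-1)‖ < 1 := by rwa [Real.norm_of_nonneg (Real.exp_pos _).le]
    exact (summable_pow_mul_geometric_of_norm_lt_one 2 hn).add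
      (summable_geometric_of_lt_one (Real.exp_pos _).le he)
  refine Summable.of_norm_bounded_eventually_nat hs ?_
  filter_upwards [h1] with n hn
  rw [Real.norm_of_nonneg (by positivity), add_mul, one_mul]
  have : Real.exp (-(r ^ n / (2 * (n + 1)))) ≤ Real.exp (-1) ^ n := by
    rw [← Real.exp_nat_mul]
    refine Real.exp_le_exp.2 ?_
    rw [mul_neg_one, neg_le_neg_iff, le_div_iff₀ (by positivity)]
    exact hn
  gcongr

/-- On survival, infinitely many generations contain nodes whose subtrees are as large as the
dimension formula requires. -/
lemma IsOffspring.ae_frequently_great [IsProbabilityMeasure ν] (h : IsOffspring ν N m) :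
    ∃ c₀ c₁ : ℝ, 0 < c₀ ∧ 0 < c₁ ∧ ∀ᵐ c ∂(envLaw N ν), Alive c →
      ∃ᶠ n : ℕ in atTop, ∃ k : ℕ, c₁ * n ≤ (N : ℝ) ^ k ∧ ∀ g ≤ n ^ 2, ∃ v ∈ lev n c,
        c₀ * N ^ (min k g) * m ^ (g - min k g) ≤ ((aliveLev g (shift v c)).card : ℝ) := by
  obtain ⟨c₀, η, hc0, hη0, hη1, hgreat⟩ := h.exists_great
  have hm := h.one_lt
  have hN := h.two_le
  obtain ⟨J, hJ⟩ : ∃ J : ℕ, (η ^ 4)⁻¹ < m ^ J := pow_unbounded_of_one_lt _ hm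
  have hJ1 : 1 ≤ η ^ 4 * m ^ J := by
    rw [inv_lt_iff_one_lt_mul₀ (by positivity)] at hJ
    linarith
  set J' := J + 1 with hJ'
  have hJ2 : 1 ≤ η ^ 4 * m ^ J' := hJ1.trans (by
    gcongr
    · exact hm.le
    · omega)
  let k : ℕ → ℕ := fun n => Nat.log N (n / J')
  let G : ℕ → ℕ → Set (List (Fin N) → ℕ) := fun n g =>
    {c | c₀ * N ^ (min (k n) g) * m ^ (g - min (k n) g) ≤ ((aliveLev g c).card : ℝ)}
  let bad : ℕ → Set (List (Fin N) → ℕ) := fun n =>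
    ⋃ g ∈ Finset.range (n ^ 2 + 1), {c | m ^ n / (n + 1) ≤ ((lev n c).card : ℝ) ∧
      ∀ v ∈ lev n c, shift v c ∉ G n g}
  have hr : 1 < Real.sqrt m := Real.lt_sqrt_of_sq_lt (by linarith)
  have hrm : Real.sqrt m ^ 2 = m := Real.sq_sqrt (by linarith)
  have hbad : ∀ n, J' ≤ n → envLaw N ν (bad n) ≤
      ENNReal.ofReal (((n : ℝ) ^ 2 + 1) * Real.exp (-(Real.sqrt m ^ n / (2 * (n + 1))))) := by
    intro n hn
    have hlog : N ^ k n ≤ n / J' :=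
      Nat.pow_log_le_self N (Nat.div_pos hn (by omega)).ne'
    have hlog' : J' * N ^ k n ≤ n := (Nat.mul_le_mul_left _ hlog).trans (Nat.mul_div_le n J')
    have hp1 : 1 ≤ η ^ (2 * N ^ k n) * Real.sqrt m ^ n := by
      have h1 : 1 ≤ (η ^ (2 * N ^ k n) * Real.sqrt m ^ n) ^ 2 := by
        calc 1 ≤ (η ^ 4 * m ^ J') ^ N ^ k n := one_le_pow₀ hJ2
          _ = (η ^ (2 * N ^ k n)) ^ 2 * m ^ (J' * N ^ k n) := by
              rw [mul_pow, ← pow_mul, ← pow_mul, ← pow_mul]; ring_nf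
          _ ≤ (η ^ (2 * N ^ k n)) ^ 2 * m ^ n := by
              gcongr
              exact hm.le
          _ = _ := by rw [mul_pow, ← pow_mul (Real.sqrt m), mul_comm n 2, pow_mul (Real.sqrt m), hrm]
      exact (one_le_sq_iff₀ (by positivity)).1 h1
    have hpM : Real.sqrt m ^ n / (2 * (n + 1)) ≤ η ^ (2 * N ^ k n) * (m ^ n / (n + 1)) / 2 := by
      have h2 : m ^ n = Real.sqrt m ^ n * Real.sqrt m ^ n := by
        rw [← pow_add, ← two_mul, pow_mul, hrm]
      have h3 : Real.sqrt m ^ n ≤ η ^ (2 * N ^ k n) * m ^ n := by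
        rw [h2]
        have : 0 ≤ Real.sqrt m ^ n := by positivity
        nlinarith
      calc Real.sqrt m ^ n / (2 * (n + 1)) ≤ η ^ (2 * N ^ k n) * m ^ n / (2 * (n + 1)) := by gcongr
        _ = _ := by field_simp
    have hone : ∀ g, envLaw N ν {c | m ^ n / (n + 1) ≤ ((lev n c).card : ℝ) ∧
        ∀ v ∈ lev n c, shift v c ∉ G n g} ≤
        ENNReal.ofReal (Real.exp (-(Real.sqrt m ^ n / (2 * (n + 1))))) := by
      intro g
      refine (measure_large_without_le h (measurableSet_le_card_aliveLev _ g) (by positivity)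
        (hgreat (k n) g) n).trans ?_
      refine ENNReal.ofReal_le_ofReal (Real.exp_le_exp.2 ?_)
      linarith
    calc envLaw N ν (bad n) ≤ _ := measure_biUnion_finset_le _ _
      _ ≤ ∑ _g ∈ Finset.range (n ^ 2 + 1),
          ENNReal.ofReal (Real.exp (-(Real.sqrt m ^ n / (2 * (n + 1))))) :=
          Finset.sum_le_sum fun g _ => hone g
      _ = _ := by
          rw [Finset.sum_const, Finset.card_range, nsmul_eq_mul,
            ENNReal.ofReal_mul (by positivity), ENNReal.ofReal_add (by positivity) zero_le_one]
          simp [ENNReal.ofReal_pow]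
  have hsum : ∑' n, envLaw N ν (if J' ≤ n then bad n else ∅) ≠ ⊤ := by
    refine ne_top_of_le_ne_top ?_ (ENNReal.tsum_le_tsum (g := fun n : ℕ =>
      ENNReal.ofReal (((n : ℝ) ^ 2 + 1) * Real.exp (-(Real.sqrt m ^ n / (2 * (n + 1)))))) ?_)
    · rw [← ENNReal.ofReal_tsum_of_nonneg (fun _ => by positivity) (summable_sq_mul_exp_neg_div hr)]
      exact ENNReal.ofReal_ne_top
    · intro n
      split_ifs with hn
      · exact hbad n hn
      · simp
  refine ⟨c₀, (1 / (J' * N) : ℝ), hc0, by positivity, ?_⟩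
  filter_upwards [ae_eventually_notMem hsum, h.ae_regular_of_alive] with c hc hreg halive
  obtain ⟨j, hj⟩ := hreg halive
  have hfreq : ∃ᶠ n : ℕ in atTop, m ^ n ≤ j * ((lev n c).card : ℝ) := by
    rw [frequently_atTop]
    exact fun k => by simpa using hj k
  refine (hfreq.and_eventually (hc.and ((eventually_ge_atTop J').and
    (eventually_ge_atTop j)))).mono ?_
  rintro n ⟨hn, hnb, hnJ, hnj⟩
  rw [if_pos hnJ] at hnb
  have hlarge : m ^ n / (n + 1) ≤ ((lev n c).card : ℝ) := by
    rw [div_le_iff₀ (by positivity), mul_comm]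
    refine hn.trans ?_
    gcongr
    have : (j : ℝ) ≤ n := by exact_mod_cast hnj
    linarith
  refine ⟨k n, ?_, fun g hg => ?_⟩
  · have h1 : n / J' < N ^ (k n + 1) := Nat.lt_pow_succ_log_self hN _
    have h2 : n < N ^ (k n + 1) * J' := (Nat.div_lt_iff_lt_mul (by omega)).1 h1
    have h3 : (n : ℝ) ≤ N ^ (k n + 1) * J' := by exact_mod_cast h2.le
    have hN0 : (0 : ℝ) < N := by exact_mod_cast (by omega : 0 < N)
    have hJ0 : (0 : ℝ) < J' := by exact_mod_cast (by omega : 0 < J')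
    rw [one_div, inv_mul_le_iff₀ (by positivity)]
    refine h3.trans_eq ?_
    ring
  · by_contra! hcon
    refine hnb (Set.mem_biUnion (x := g) (Finset.mem_coe.2 (Finset.mem_range.2 (by omega)))
      ⟨hlarge, fun v hv hvG => ?_⟩)
    exact absurd hvG (not_le.2 (hcon v hv))

end GWTree

namespace GWTree

lemma ballLen_le {r : ℝ} (h0 : 0 < r) (h1 : r ≤ 1) : (ballLen r : ℝ) ≤ Real.log (1 / r) + 1 := by
  have : 0 ≤ Real.log (1 / r) := Real.log_nonneg (by rw [le_div_iff₀ h0]; linarith)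
  rw [ballLen]
  push_cast
  linarith [Nat.floor_le this]

lemma lt_ballLen (r : ℝ) : Real.log (1 / r) < ballLen r := by
  rw [ballLen]
  push_cast
  exact Nat.lt_floor_add_one _

lemma ballLen_mono {r R : ℝ} (h0 : 0 < r) (h : r ≤ R) : ballLen R ≤ ballLen r := by
  have hR : 0 < R := h0.trans_le h
  refine Nat.succ_le_succ (Nat.floor_le_floor ?_)
  exact Real.log_le_log (by positivity) (one_div_le_one_div_of_le h0 h)

lemma log_div_eq {r R : ℝ} (h0 : 0 < r) (hR : 0 < R) :
    Real.log (R / r) = Real.log (1 / r) - Real.log (1 / R) := by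
  rw [Real.log_div hR.ne' h0.ne', one_div, one_div, Real.log_inv, Real.log_inv]; ring

lemma toENNReal_le_ofReal {k : ℕ∞} {n : ℕ} {b : ℝ} (h : k ≤ n) (hb : (n : ℝ) ≤ b) :
    (k : ℝ≥0∞) ≤ ENNReal.ofReal b := by
  calc (k : ℝ≥0∞) ≤ ((n : ℕ∞) : ℝ≥0∞) := by exact_mod_cast h
    _ = ENNReal.ofReal n := by simp
    _ ≤ _ := ENNReal.ofReal_le_ofReal hb

lemma le_of_ofNat_le_toENNReal {k : ℕ∞} {n : ℕ} {b : ℝ} (h : (n : ℕ∞) ≤ k) (hb0 : 0 ≤ b)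
    (hb : (k : ℝ≥0∞) ≤ ENNReal.ofReal b) : (n : ℝ) ≤ b := by
  have h1 : ((n : ℕ∞) : ℝ≥0∞) ≤ (k : ℝ≥0∞) := by exact_mod_cast h
  have h2 : ENNReal.ofReal n ≤ ENNReal.ofReal b := by
    refine le_trans (le_of_eq ?_) (h1.trans hb)
    simp
  exact (ENNReal.ofReal_le_ofReal_iff hb0).1 h2

end GWTree

namespace AssouadDim

lemma phiAssouadDim_le_upperPhiAssouadDim (φ : ℝ → ℝ) (F : Type*) [PseudoMetricSpace F] :
    phiAssouadDim φ F ≤ upperPhiAssouadDim φ F := by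
  refine le_iInf₂ fun s hs => iInf₂_le s ?_
  obtain ⟨C, hC, h⟩ := hs
  refine ⟨C, hC, fun R hR0 hR1 x => ?_⟩
  refine (h (R ^ (1 + φ R)) R (by positivity) le_rfl hR0 hR1 x).trans_eq ?_
  have : R / R ^ (1 + φ R) = R ^ (-φ R) := by
    rw [Real.rpow_add hR0, Real.rpow_one, Real.rpow_neg hR0.le]
    field_simp
  rw [this, ← Real.rpow_mul hR0.le, neg_mul]

lemma upperPhiAssouadDim_le_assouadDim {φ : ℝ → ℝ} (hφ : ∀ R ∈ Set.Ioo (0 : ℝ) 1, 0 < φ R)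
    (F : Type*) [PseudoMetricSpace F] : upperPhiAssouadDim φ F ≤ assouadDim F := by
  refine le_iInf₂ fun s hs => iInf₂_le s ?_
  obtain ⟨C, hC, h⟩ := hs
  refine ⟨C, hC, fun r R hr0 hrR hR0 hR1 x => h r R hr0 (hrR.trans ?_) hR1 x⟩
  calc R ^ (1 + φ R) ≤ R ^ (1 : ℝ) :=
        Real.rpow_le_rpow_of_exponent_ge hR0 hR1.le (by linarith [hφ R ⟨hR0, hR1⟩])
    _ = R := Real.rpow_one R

lemma logLogRate_div_eq (φ : ℝ → ℝ) (R : ℝ) :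
    logLogRate R / φ R = Real.log (Real.log (1 / R)) / (φ R * Real.log (1 / R)) := by
  rw [logLogRate, div_div, mul_comm]

end AssouadDim

namespace GWTree

lemma assouadDim_boundary_le {N : ℕ} (hN : 1 ≤ N) (c : List (Fin N) → ℕ) :
    assouadDim (boundary c) ≤ ((Real.log N : ℝ) : EReal) := by
  have hN0 : (0 : ℝ) < N := by exact_mod_cast hN
  have hN1 : (1 : ℝ) ≤ N := by exact_mod_cast hN
  refine iInf₂_le (Real.log N) ⟨N, hN0, fun r R hr0 hrR hR1 x => ?_⟩
  have hR0 : 0 < R := hr0.trans_le hrR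
  have hcov := ballCoverNumber_le x hr0 (hrR.trans hR1.le) hR0 hR1.le rfl
    (Nat.add_sub_cancel' (ballLen_mono hr0 hrR)).symm
  set g := ballLen r - ballLen R with hg
  refine toENNReal_le_ofReal hcov ?_
  have h1 : ((lev g (shift (x.1.take (ballLen R)) c)).card : ℝ) ≤ (N : ℝ) ^ g := by
    exact_mod_cast card_lev_le _ _
  have hgG : (g : ℝ) ≤ 1 + Real.log (R / r) := by
    rw [hg, Nat.cast_sub (ballLen_mono hr0 hrR), log_div_eq hr0 hR0]
    linarith [ballLen_le hr0 (hrR.trans hR1.le), lt_ballLen R]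
  refine h1.trans ?_
  rw [← Real.rpow_natCast]
  refine (Real.rpow_le_rpow_of_exponent_le hN1 hgG).trans_eq ?_
  rw [Real.rpow_add hN0, Real.rpow_one, Real.rpow_def_of_pos hN0,
    Real.rpow_def_of_pos (by positivity), mul_comm (Real.log N)]

lemma log_le_mul_sub {x ε : ℝ} (hx : 0 < x) (hε : 0 < ε) :
    Real.log x ≤ ε * x - 1 - Real.log ε := by
  have := Real.log_le_sub_one_of_pos (mul_pos hε hx)
  rw [Real.log_mul hε.ne' hx.ne'] at this
  linarith

/-- An iterated logarithm bound, uniform in the two scales. -/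
lemma exists_log_add_le {φ : ℝ → ℝ} (hφ : IsDimensionFunction φ) {α : ℝ} (hα : 0 ≤ α)
    (hlim : Tendsto (fun R => logLogRate R / φ R) (𝓝[>] 0) (𝓝 α)) {ε : ℝ} (hε : 0 < ε) :
    ∃ B : ℝ, ∀ R G : ℝ, 0 < R → R < 1 → φ R * Real.log (1 / R) ≤ G →
      Real.log (Real.log (1 / R) + G + 3) ≤ (α + 2 * ε) * G + B := by
  have hev : ∀ᶠ R in 𝓝[>] (0 : ℝ), logLogRate R / φ R < α + ε :=
    hlim.eventually (gt_mem_nhds (by linarith))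
  obtain ⟨R₁, hR₁, hR₁'⟩ := mem_nhdsGT_iff_exists_Ioo_subset.1 hev
  set R₀ := min R₁ (Real.exp (-1)) with hR₀
  have hR₀pos : 0 < R₀ := lt_min hR₁ (Real.exp_pos _)
  have hR₀e : R₀ ≤ Real.exp (-1) := min_le_right _ _
  set L₀ := Real.log (1 / R₀)
  have hL₀ : 1 ≤ L₀ := by
    rw [Real.le_log_iff_exp_le (by positivity), le_div_iff₀ hR₀pos]
    calc Real.exp 1 * R₀ ≤ Real.exp 1 * Real.exp (-1) := by gcongr
      _ = 1 := by rw [← Real.exp_add]; simp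
  refine ⟨ε * (L₀ + 4) - 1 - Real.log ε, fun R G hR0 hR1 hG => ?_⟩
  set L := Real.log (1 / R)
  have hL : 0 < L := Real.log_pos (by rw [lt_div_iff₀ hR0]; linarith)
  have hφR := hφ.pos R ⟨hR0, hR1⟩
  have hG0 : 0 < G := lt_of_lt_of_le (mul_pos hφR hL) hG
  by_cases hR : R < R₀
  · have hlt : logLogRate R / φ R < α + ε := hR₁' ⟨hR0, hR.trans_le (min_le_left _ _)⟩
    rw [logLogRate_div_eq, div_lt_iff₀ (mul_pos hφR hL)] at hlt
    have hLL : L₀ ≤ L := Real.log_le_log (by positivity) (one_div_le_one_div_of_le hR0 hR.le)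
    have h1 : (α + ε) * (φ R * L) ≤ (α + ε) * G := by gcongr
    have h2 : Real.log (L + G + 3) ≤ Real.log (L * (G + 4)) :=
      Real.log_le_log (by linarith) (by nlinarith)
    rw [Real.log_mul hL.ne' (by linarith)] at h2
    have h3 := log_le_mul_sub (x := G + 4) (by linarith) hε
    have h4 : Real.log L < (α + ε) * (φ R * L) := hlt
    nlinarith
  · have hLL : L ≤ L₀ :=
      Real.log_le_log (by positivity) (one_div_le_one_div_of_le hR₀pos (not_lt.1 hR))
    have h3 := log_le_mul_sub (x := L + G + 3) (by linarith) hε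
    have h4 : 0 ≤ (α + ε) * G := by positivity
    nlinarith

lemma upperPhiAssouadDim_boundary_le {N : ℕ} {c : List (Fin N) → ℕ} {A m γ : ℝ} (hA : 0 < A)
    (hm : 1 < m) (hγ0 : 0 ≤ γ) (hγ1 : γ ≤ 1)
    (hc : ∀ (g : ℕ) (v : List (Fin N)), ((lev g (shift v c)).card : ℝ) ≤
      A * ((v.length + g + 1 : ℕ) : ℝ) ^ γ * m ^ g)
    {φ : ℝ → ℝ} (hφ : IsDimensionFunction φ) {α : ℝ} (hα : 0 ≤ α)
    (hlim : Tendsto (fun R => logLogRate R / φ R) (𝓝[>] 0) (𝓝 α)) :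
    upperPhiAssouadDim φ (boundary c) ≤ ((α * γ + Real.log m : ℝ) : EReal) := by
  by_contra! hcon
  obtain ⟨s, hs1, hs2⟩ := EReal.lt_iff_exists_real_btwn.1 hcon
  rw [EReal.coe_lt_coe_iff] at hs1
  refine absurd hs2 (not_lt.2 (iInf₂_le s ?_))
  set ε := (s - (α * γ + Real.log m)) / 2 with hεdef
  have hε : 0 < ε := by rw [hεdef]; linarith
  obtain ⟨B, hB⟩ := exists_log_add_le hφ hα hlim hε
  refine ⟨A * Real.exp (γ * B + Real.log m), by positivity, fun r R hr0 hrR' hR0 hR1 x => ?_⟩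
  have hφR := hφ.pos R ⟨hR0, hR1⟩
  have hrR : r ≤ R := hrR'.trans (by
    calc R ^ (1 + φ R) ≤ R ^ (1 : ℝ) :=
          Real.rpow_le_rpow_of_exponent_ge hR0 hR1.le (by linarith)
      _ = R := Real.rpow_one R)
  have hr1 : r ≤ 1 := hrR.trans hR1.le
  have hcov := ballCoverNumber_le x hr0 hr1 hR0 hR1.le rfl
    (Nat.add_sub_cancel' (ballLen_mono hr0 hrR)).symm
  set g := ballLen r - ballLen R with hg
  set G := Real.log (R / r) with hG
  have hGeq := log_div_eq hr0 hR0
  have hφG : φ R * Real.log (1 / R) ≤ G := by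
    have h1 : Real.log r ≤ (1 + φ R) * Real.log R := by
      rw [← Real.log_rpow hR0]
      exact Real.log_le_log hr0 hrR'
    rw [hG, Real.log_div hR0.ne' hr0.ne', one_div, Real.log_inv]
    linarith
  have hLpos : 0 < Real.log (1 / R) := Real.log_pos (by rw [lt_div_iff₀ hR0]; linarith)
  have hG0 : 0 < G := (mul_pos hφR hLpos).trans_le hφG
  have hlogm : 0 < Real.log m := Real.log_pos hm
  refine toENNReal_le_ofReal hcov ((hc _ _).trans ?_)
  rw [InfWord.length_take, Nat.add_sub_cancel' (ballLen_mono hr0 hrR)]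
  have hgG : (g : ℝ) ≤ 1 + G := by
    rw [hg, Nat.cast_sub (ballLen_mono hr0 hrR), hG, hGeq]
    linarith [ballLen_le hr0 hr1, lt_ballLen R]
  have hM : ((ballLen r + 1 : ℕ) : ℝ) ≤ Real.log (1 / R) + G + 3 := by
    push_cast
    rw [hG, hGeq]
    linarith [ballLen_le hr0 hr1]
  have h1 : ((ballLen r + 1 : ℕ) : ℝ) ^ γ ≤ Real.exp (γ * ((α + 2 * ε) * G + B)) := by
    have hpos : (0 : ℝ) < ((ballLen r + 1 : ℕ) : ℝ) := by positivity
    rw [Real.rpow_def_of_pos hpos, mul_comm]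
    refine Real.exp_le_exp.2 (mul_le_mul_of_nonneg_left ?_ hγ0)
    exact (Real.log_le_log hpos hM).trans (hB R G hR0 hR1 hφG)
  have h2 : m ^ g ≤ Real.exp (Real.log m * (1 + G)) := by
    rw [← Real.rpow_natCast, Real.rpow_def_of_pos (by linarith)]
    exact Real.exp_le_exp.2 (mul_le_mul_of_nonneg_left hgG hlogm.le)
  calc A * ((ballLen r + 1 : ℕ) : ℝ) ^ γ * m ^ g
      ≤ A * Real.exp (γ * ((α + 2 * ε) * G + B)) * Real.exp (Real.log m * (1 + G)) := by gcongr
    _ = A * Real.exp (γ * ((α + 2 * ε) * G + B) + Real.log m * (1 + G)) := by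
        rw [Real.exp_add]; ring
    _ ≤ A * Real.exp (γ * B + Real.log m + G * s) := by
        refine mul_le_mul_of_nonneg_left (Real.exp_le_exp.2 ?_) hA.le
        have h5 : γ * (2 * ε) * G ≤ 1 * (2 * ε) * G := by gcongr
        have h6 : s = α * γ + Real.log m + 2 * ε := by rw [hεdef]; ring
        rw [h6]
        linarith
    _ = A * Real.exp (γ * B + Real.log m) * (R / r) ^ s := by
        rw [Real.exp_add, Real.rpow_def_of_pos (by positivity)]; ring

lemma ballLen_exp_neg {x : ℝ} : ballLen (Real.exp (-x)) = ⌊x⌋₊ + 1 := by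
  rw [ballLen, one_div, ← Real.exp_neg, neg_neg, Real.log_exp]

lemma le_phiAssouadDim_boundary {N : ℕ} {c : List (Fin N) → ℕ} {m c₀ c₁ : ℝ} (hN : 2 ≤ N)
    (hm : 1 < m) (hmN : m ≤ N) (hc₀ : 0 < c₀) (hc₁ : 0 < c₁)
    (hc : ∃ᶠ n : ℕ in atTop, ∃ k : ℕ, c₁ * n ≤ (N : ℝ) ^ k ∧ ∀ g ≤ n ^ 2, ∃ v ∈ lev n c,
        c₀ * N ^ (min k g) * m ^ (g - min k g) ≤ ((aliveLev g (shift v c)).card : ℝ))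
    {φ : ℝ → ℝ} (hφ : IsDimensionFunction φ) {a : ℝ} (haN : a ≤ Real.log N)
    (hlim : ∀ ε > 0, ∀ᶠ R in 𝓝[>] (0 : ℝ), a - ε ≤ logLogRate R / φ R) :
    ((a * (1 - Real.log m / Real.log N) + Real.log m : ℝ) : EReal) ≤
      phiAssouadDim φ (boundary c) := by
  refine le_iInf₂ fun s hs => ?_
  obtain ⟨C, hC, hcov⟩ := hs
  rw [EReal.coe_le_coe_iff]
  by_contra! hlt
  have hN0 : (0 : ℝ) < N := by positivity
  have hlogN : 0 < Real.log N := Real.log_pos (by exact_mod_cast hN)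
  have hlogm : 0 < Real.log m := Real.log_pos hm
  set γ := 1 - Real.log m / Real.log N with hγ
  have hγ0 : 0 ≤ γ := by
    rw [hγ, sub_nonneg, div_le_one hlogN]
    exact Real.log_le_log (by linarith) hmN
  have hγ1 : γ ≤ 1 := by
    have : 0 ≤ Real.log m / Real.log N := by positivity
    linarith
  have hγN : Real.log N - Real.log m = γ * Real.log N := by rw [hγ]; field_simp
  set ε := (a * γ + Real.log m - s) / 2 with hε
  have hε0 : 0 < ε := by rw [hε]; linarith
  set B := |Real.log c₁| + Real.log N with hB
  set D := (Real.log C - Real.log c₀ + γ * B + Real.log m) / ε with hD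
  have hR : Tendsto (fun n : ℕ => Real.exp (-((n : ℝ) - 1))) atTop (𝓝[>] 0) := by
    refine tendsto_nhdsWithin_iff.2 ⟨?_, Eventually.of_forall fun n => Real.exp_pos _⟩
    refine Real.tendsto_exp_neg_atTop_nhds_zero.comp ?_
    exact tendsto_atTop_add_const_right _ _ tendsto_natCast_atTop_atTop
  have hK : ∀ᶠ R in 𝓝[>] (0 : ℝ), R < 1 / 2 :=
    mem_nhdsWithin_of_mem_nhds (gt_mem_nhds (by norm_num))
  have hev := hR.eventually ((hlim ε hε0).and ((hφ.gap_tendsto.eventually_gt_atTop (max D 0)).and hK))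
  obtain ⟨n, ⟨k, hk, hg⟩, ⟨hlo, hgap, hRhalf⟩, hn2, hnK⟩ :=
    (hc.and_eventually (hev.and ((eventually_ge_atTop 2).and
      (eventually_ge_atTop ⌈φ (1 / 2)⌉₊)))).exists
  set L : ℝ := (n : ℝ) - 1 with hL
  have hn2' : (2 : ℝ) ≤ n := by exact_mod_cast hn2
  have hL1 : 1 ≤ L := by linarith
  set R := Real.exp (-L) with hRdef
  have hlogR : Real.log (1 / R) = L := by
    rw [hRdef, one_div, ← Real.exp_neg, neg_neg, Real.log_exp]
  have hR0 : 0 < R := Real.exp_pos _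
  have hR1 : R < 1 := by linarith
  rw [logLogRate_div_eq, hlogR] at hlo
  rw [hlogR] at hgap
  set G := φ R * L with hG
  have hG0 : 0 < G := (le_max_right _ _).trans_lt hgap
  have hDG : D < G := (le_max_left _ _).trans_lt hgap
  rw [le_div_iff₀ hG0] at hlo
  have hφK : φ R ≤ n := by
    refine (hφ.monotone ⟨hR0, hR1⟩ ⟨by norm_num, by norm_num⟩ hRhalf.le).trans ?_
    exact (Nat.le_ceil _).trans (by exact_mod_cast hnK)
  have hgn : ⌊G⌋₊ ≤ n ^ 2 := by
    refine Nat.floor_le_of_le ?_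
    push_cast
    rw [hG, pow_two]
    have : L ≤ n := by linarith
    gcongr
  obtain ⟨v, hv, hS⟩ := hg _ hgn
  set g := ⌊G⌋₊ with hgdef
  set κ := min k g with hκ
  have hpos : 0 < c₀ * N ^ κ * m ^ (g - κ) := by positivity
  obtain ⟨u, hu⟩ : (aliveLev g (shift v c)).Nonempty := by
    rw [← Finset.card_pos]
    exact_mod_cast hpos.trans_le hS
  have hu' : u ∈ lev g (shift v c) ∧ Alive (shift u (shift v c)) := by
    classical simpa [aliveLev] using hu
  rw [shift_shift] at hu'
  obtain ⟨z, hz, hzt⟩ := exists_mem_boundary_take ((append_mem_lev hv).2 hu'.1) hu'.2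
  have hzn : z.take n = v := by
    rw [← InfWord.take_take z n g, hzt, List.take_left' (length_of_mem_lev hv)]
  have hr : R ^ (1 + φ R) = Real.exp (-(L + G)) := by
    rw [hRdef, ← Real.exp_mul, ← hRdef, hG]; ring_nf
  have hLn : ⌊L⌋₊ + 1 = n := by
    have : L = ((n - 1 : ℕ) : ℝ) := by rw [Nat.cast_sub (by omega)]; simp [hL]
    rw [this, Nat.floor_natCast]; omega
  have hbR : ballLen R = n := by rw [hRdef, ballLen_exp_neg, hLn]
  have hbr : ballLen (R ^ (1 + φ R)) = n + g := by
    rw [hr, ballLen_exp_neg]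
    have : L = ((n - 1 : ℕ) : ℝ) := by rw [Nat.cast_sub (by omega)]; simp [hL]
    rw [this, add_comm _ G, Nat.floor_add_natCast hG0.le]; omega
  have hr1 : R ^ (1 + φ R) ≤ 1 := by
    rw [hr]
    exact Real.exp_le_one_iff.2 (by linarith)
  have hlow := le_ballCoverNumber (⟨z, hz⟩ : boundary c) (by positivity) hr1 hR0 hR1.le hbR hbr
  simp only [hzn] at hlow
  have hfin := hS.trans (le_of_ofNat_le_toENNReal hlow (by positivity) (hcov R hR0 hR1 ⟨z, hz⟩))
  have hRs : R ^ (-(φ R * s)) = Real.exp (G * s) := by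
    rw [hRdef, ← Real.exp_mul, ← hRdef, hG]; ring_nf
  rw [hRs] at hfin
  have hlog := Real.log_le_log hpos hfin
  rw [Real.log_mul (by positivity) (by positivity), Real.log_mul hc₀.ne' (by positivity),
    Real.log_mul hC.ne' (Real.exp_pos _).ne', Real.log_exp, Real.log_pow, Real.log_pow,
    Nat.cast_sub (min_le_right k g)] at hlog
  have hgG : G - 1 < g := Nat.sub_one_lt_floor G
  have hκN : (a - ε) * G - B ≤ κ * Real.log N := by
    rcases min_choice k g with hmin | hmin
    · rw [hκ, hmin, ← Real.log_pow]
      have h1 : Real.log (c₁ * n) ≤ Real.log ((N : ℝ) ^ k) :=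
        Real.log_le_log (by positivity) hk
      rw [Real.log_mul hc₁.ne' (by positivity)] at h1
      have h2 : Real.log L ≤ Real.log n := Real.log_le_log (by linarith) (by linarith)
      have h3 := neg_abs_le (Real.log c₁)
      linarith
    · rw [hκ, hmin]
      have h1 : (G - 1) * Real.log N ≤ g * Real.log N := by gcongr
      have h2 : (a - ε) * G ≤ Real.log N * G := by gcongr; linarith
      have h3 := abs_nonneg (Real.log c₁)
      linarith
  have h1 : γ * ((a - ε) * G - B) ≤ γ * (κ * Real.log N) := by gcongr
  have h2 : (G - 1) * Real.log m ≤ g * Real.log m := by gcongr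
  have h3 : (κ : ℝ) * Real.log N - κ * Real.log m = γ * (κ * Real.log N) := by
    rw [← mul_sub, hγN]; ring
  have h4 : Real.log C - Real.log c₀ + γ * B + Real.log m < ε * G := by
    rw [hD, div_lt_iff₀ hε0] at hDG
    linarith
  have h5 : γ * ε * G ≤ 1 * ε * G := by gcongr
  have h6 : s = a * γ + Real.log m - 2 * ε := by rw [hε]; ring
  rw [h6] at hlog
  have h7 : ((g : ℝ) - κ) * Real.log m = g * Real.log m - κ * Real.log m := by ring
  linarith

end GWTree

theorem theoremF {Ω : Type*} [MeasurableSpace Ω] (P : Measure Ω) [IsProbabilityMeasure P]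
    -- the offspring distribution, finitely supported with maximal offspring `N` and mean `m > 1`
    (ν : Measure ℕ) [IsProbabilityMeasure ν]
    (N : ℕ) (hN : IsGreatest {n : ℕ | 0 < ν {n}} N)
    (m : ℝ) (hm : m = ∫ n, (n : ℝ) ∂ν) (hm1 : 1 < m)
    -- independent offspring numbers of all finite words, each distributed as `ν`
    (X : List (Fin N) → Ω → ℕ) (hX : ∀ v, Measurable (X v))
    (hlaw : ∀ v, P.map (X v) = ν) (hindep : iIndepFun X P) :
    ∀ᵐ ω ∂P, (∀ k, 0 < genSize (fun v => X v ω) k) →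
      ∀ φ : ℝ → ℝ, IsDimensionFunction φ →
        (∀ α : ℝ, 0 ≤ α → α ≤ Real.log N →
          Tendsto (fun R => logLogRate R / φ R) (𝓝[>] 0) (𝓝 α) →
            upperPhiAssouadDim φ (boundary (fun v => X v ω))
                = ((α * (1 - Real.log m / Real.log N) + Real.log m : ℝ) : EReal) ∧
            phiAssouadDim φ (boundary (fun v => X v ω))
                = ((α * (1 - Real.log m / Real.log N) + Real.log m : ℝ) : EReal)) ∧
        (∀ α : EReal, ((Real.log N : ℝ) : EReal) ≤ α →
          Tendsto (fun R => ((logLogRate R / φ R : ℝ) : EReal)) (𝓝[>] 0) (𝓝 α) →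
            assouadDim (boundary (fun v => X v ω)) = ((Real.log N : ℝ) : EReal) ∧
            phiAssouadDim φ (boundary (fun v => X v ω)) = ((Real.log N : ℝ) : EReal)) := by
  have h := isOffspring_of_isGreatest hN hm hm1
  obtain ⟨c₀, c₁, hc₀, hc₁, hgreat⟩ := h.ae_frequently_great
  have hmap := map_family_eq_envLaw hX hlaw hindep
  have hmeas : AEMeasurable (fun ω v => X v ω) P :=
    (measurable_pi_lambda _ fun v => hX v).aemeasurable
  have hupper := h.ae_card_lev_le
  rw [← hmap] at hgreat hupper
  filter_upwards [ae_of_ae_map hmeas hgreat, ae_of_ae_map hmeas hupper] with ω hω hA hsurv φ hφ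
  have halive : Alive fun v => X v ω := fun k => Finset.card_pos.1 (by
    rw [← genSize_eq]; exact hsurv k)
  obtain ⟨A, hA0, hAle⟩ := hA
  have hfreq := hω halive
  have hβ0 := h.log_div_nonneg
  have hβ1 := h.log_div_le_one
  refine ⟨fun α hα0 hαN hlim => ?_, fun α hα hlim => ?_⟩
  · have hup := upperPhiAssouadDim_boundary_le hA0 hm1 (by linarith) (by linarith) hAle hφ hα0 hlim
    have hlo := le_phiAssouadDim_boundary h.two_le hm1 h.mean_le hc₀ hc₁ hfreq hφ hαN
      fun ε hε => (hlim.eventually (lt_mem_nhds (sub_lt_self α hε))).mono fun _ hR => hR.le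
    have hle := phiAssouadDim_le_upperPhiAssouadDim φ (boundary fun v => X v ω)
    exact ⟨le_antisymm hup (hlo.trans hle), le_antisymm (hle.trans hup) hlo⟩
  · have hup := assouadDim_boundary_le (by linarith [h.two_le]) fun v => X v ω
    have hlo := le_phiAssouadDim_boundary h.two_le hm1 h.mean_le hc₀ hc₁ hfreq hφ le_rfl
      fun ε hε => (hlim.eventually (lt_mem_nhds (lt_of_lt_of_le
        (EReal.coe_lt_coe_iff.2 (sub_lt_self (Real.log N) hε)) hα))).mono
        fun _ hR => (EReal.coe_lt_coe_iff.1 hR).le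
    have hval : Real.log N * (1 - Real.log m / Real.log N) + Real.log m = Real.log N := by
      have := h.log_pos.ne'
      field_simp
      ring
    rw [hval] at hlo
    have hle := (phiAssouadDim_le_upperPhiAssouadDim φ (boundary fun v => X v ω)).trans
      (upperPhiAssouadDim_le_assouadDim hφ.pos _)
    exact ⟨le_antisymm hup (hlo.trans hle), le_antisymm (hle.trans hup) hlo⟩
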